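/- Let $a,b>0$, $\Omega=(0,a)\times(0,b)\subset\mathbb R^2$, and let $\varphi_1,\dots,\varphi_M>0$ and $\sigma>0$. Let $$X=\{\theta=(\kappa,\xi_0^2,G):\ \kappa\in[0,1],\ \xi_0^2>0,\ G>0\}\subset\mathbb R^3 ,$$ and for $\theta\in X$ let $g_\theta(s)=1/G$ for $s\le\xi_0^2$ and $g_\theta(s)=\frac1G\,(s/\xi_0^2)^{(1-\kappa)/2}$ for $s>\xi_0^2$ (the Ramberg–Osgood plasticity function). A weak solution of $$-\nabla\cdot\big(g_\theta(|\nabla u|^2)\nabla u\big)=2\varphi\ \text{ in }\Omega,\qquad u=0\ \text{ on }\partial\Omega,$$ is a function $u\in H^1_0(\Omega)$ such that for every $v\in H^1_0(\Omega)$ the function $g_\theta(|\nabla u|^2)\nabla u\cdot\nabla v$ is integrable on $\Omega$ and $\int_\Omega g_\theta(|\nabla u|^2)\nabla u\cdot\nabla v\,dx\,dy=2\varphi\int_\Omega v\,dx\,dy$. Let $\mu_0$ be any Borel probability measure on $X$ (the prior). Then the Bayesian inverse problem of recovering $\theta$ from $d=\mathbb F(\theta)+\varepsilon$, with $\varepsilon\sim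 N(0,\sigma^2 I)$ independent of $\theta\sim\mu_0$, is well-defined and well-posed in the following sense. 1. For every $\theta\in X$ and every $i$ there is exactly one weak solution $u(\cdot\,;\theta,\varphi_i)$ with $\varphi=\varphi_i$; hence the torque observation operator $\mathbb F:X\to\mathbb R^M$, $\mathbb F(\theta)_i=2\int_\Omega u(x,y;\theta,\varphi_i)\,dx\,dy$, is well-defined. 2. For every $y\in\mathbb R^M$ the constant $Z(y)=\int_X\exp\big(-\tfrac1{2\sigma^2}\|y-\mathbb F(\theta)\|^2\big)\,d\mu_0(\theta)$ satisfies $0<Z(y)<\infty$. 3. The measures $\mu^y$ given by $$\frac{d\mu^y}{d\mu_0}(\theta)=\frac1{Z(y)}\exp\Big(-\frac1{2\sigma^2}\|y-\mathbb F(\theta)\|^2\Big)$$ form a Markov kernel $y\mapsto\mu^y$ from $\mathbb R^M$ to $X$. Whenever $\theta$ and $\varepsilon$ are independent random variables on a probability space with laws $\mu_0$ and $N(0,\sigma^2I)$, $d=\mathbb F(\theta)+\varepsilon$ is a random variable and $y\mapsto\mu^y$ is a regular conditional distribution of $\theta$ given $d$ (the posterior); any other Markov kernel that is a regular conditional distribution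 of $\theta$ given $d$ agrees with it for almost every $y$ with respect to the law of $d$. 4. The posterior depends continuously on the data: for every $r>0$ there is a constant $L$ such that for all $y,y'\in\mathbb R^M$ with $\|y\|,\|y'\|\le r$, $$d_{\mathrm{Hell}}(\mu^{y},\mu^{y'})\le L\,\|y-y'\| ,$$ where $d_{\mathrm{Hell}}(\mu,\nu)^2=\frac12\int\big(\sqrt{d\mu/d\lambda}-\sqrt{d\nu/d\lambda}\big)^2d\lambda$ with $\lambda=\mu+\nu$ (the value is the same for every $\sigma$-finite measure $\lambda$ dominating $\mu$ and $\nu$). -/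

import Mathlib

open MeasureTheory ProbabilityTheory
open scoped ENNReal ContDiff

noncomputable section

namespace Torsion

/-- The plane with its Euclidean norm. -/
abbrev Plane : Type := EuclideanSpace ℝ (Fin 2)

/-- The cross section `Ω = (0,a) × (0,b)`. -/
def rect (a b : ℝ) : Set Plane :=
  {x | x 0 ∈ Set.Ioo 0 a ∧ x 1 ∈ Set.Ioo 0 b}

/-- Pairs `w = (u, p)` with `u ∈ L²(Ω)` and `p ∈ L²(Ω; ℝ²)`. A Sobolev function `u` is
represented by the pair `(u, ∇u)`. -/
abbrev L2Pair (a b : ℝ) : Type :=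
  Lp ℝ 2 (volume.restrict (rect a b)) × Lp Plane 2 (volume.restrict (rect a b))

/-- Test functions: smooth with compact support contained in `Ω`. -/
def IsTest (a b : ℝ) (ψ : Plane → ℝ) : Prop :=
  ContDiff ℝ ∞ ψ ∧ HasCompactSupport ψ ∧ tsupport ψ ⊆ rect a b

/-- `H¹(Ω)`: the pairs `(u, p)` such that `p` is the weak gradient of `u`. -/
def H1 (a b : ℝ) : Set (L2Pair a b) :=
  {w | ∀ ψ : Plane → ℝ, IsTest a b ψ → ∀ e : Plane,
    ∫ x in rect a b, w.1 x * inner ℝ (gradient ψ x) e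
      = - ∫ x in rect a b, inner ℝ (w.2 x) e * ψ x}

/-- The pairs `(ψ, ∇ψ)` with `ψ` a test function. -/
def testPairs (a b : ℝ) : Set (L2Pair a b) :=
  {w | ∃ ψ : Plane → ℝ, IsTest a b ψ ∧
    (w.1 : Plane → ℝ) =ᵐ[volume.restrict (rect a b)] ψ ∧
    (w.2 : Plane → Plane) =ᵐ[volume.restrict (rect a b)] gradient ψ}

/-- `H¹₀(Ω)`: the closure of the test functions in `H¹(Ω)`. The topology of
`L²(Ω) × L²(Ω; ℝ²)` on pairs `(u, ∇u)` is that of the `H¹` norm. -/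
def H10 (a b : ℝ) : Set (L2Pair a b) :=
  H1 a b ∩ closure (testPairs a b)

/-- Admissible parameters `θ = (κ, ξ₀², G)`: `κ ∈ [0,1]`, `ξ₀² > 0`, `G > 0`. -/
def paramSet : Set (ℝ × ℝ × ℝ) :=
  {θ | θ.1 ∈ Set.Icc 0 1 ∧ 0 < θ.2.1 ∧ 0 < θ.2.2}

/-- The parameter space `X`. -/
abbrev Param : Type := paramSet

/-- The Ramberg–Osgood plasticity function `s ↦ g(s)` of the variable `s = ξ²`. -/
def plasticity (θ : Param) (s : ℝ) : ℝ :=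
  if s ≤ θ.1.2.1 then 1 / θ.1.2.2
  else 1 / θ.1.2.2 * (s / θ.1.2.1) ^ ((1 - θ.1.1) / 2)

/-- `w = (u, ∇u)` is a weak solution of `-∇·(g(|∇u|²)∇u) = 2φ` in `Ω`, `u = 0` on `∂Ω`:
`u ∈ H¹₀(Ω)` and for all `v ∈ H¹₀(Ω)` the integral on the left exists and
`∫ g(|∇u|²) ∇u·∇v = 2φ ∫ v`. -/
def IsWeakSolution (a b : ℝ) (θ : Param) (φ : ℝ) (w : L2Pair a b) : Prop :=
  w ∈ H10 a b ∧ ∀ v ∈ H10 a b,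
    IntegrableOn (fun x => plasticity θ (‖w.2 x‖ ^ 2) * inner ℝ (w.2 x) (v.2 x)) (rect a b) ∧
    ∫ x in rect a b, plasticity θ (‖w.2 x‖ ^ 2) * inner ℝ (w.2 x) (v.2 x)
      = 2 * φ * ∫ x in rect a b, v.1 x

/-- The solution of the direct problem (meaningful as there is exactly one). -/
def solution (a b : ℝ) (θ : Param) (φ : ℝ) : L2Pair a b :=
  Classical.epsilon (IsWeakSolution a b θ φ)

/-- The data space `ℝ^M`. -/
abbrev Data (M : ℕ) : Type := EuclideanSpace ℝ (Fin M)

/-- The observation operator: the torques `2 ∫_Ω u(x; φᵢ) dx` at the angles `φᵢ`. -/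
def observe (a b : ℝ) {M : ℕ} (φ : Fin M → ℝ) (θ : Param) : Data M :=
  WithLp.toLp 2 fun i => 2 * ∫ x in rect a b, (solution a b θ (φ i)).1 x

/-- The (unnormalized) likelihood `exp(-½ ‖C^{-1/2}(y - F(θ))‖²)` for `C = σ² I`. -/
def likelihood {M : ℕ} (F : Param → Data M) (σ : ℝ) (y : Data M) (θ : Param) : ℝ :=
  Real.exp (-(1 / 2) * ‖σ⁻¹ • (y - F θ)‖ ^ 2)

/-- The normalizing constant `Z(y) = ∫ exp(-½ ‖C^{-1/2}(y - F(θ))‖²) dμ₀(θ)`. -/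
def evidence {M : ℕ} (F : Param → Data M) (σ : ℝ) (μ₀ : Measure Param) (y : Data M) : ℝ≥0∞ :=
  ∫⁻ θ, ENNReal.ofReal (likelihood F σ y θ) ∂μ₀

/-- The measure given by Bayes' rule: density `Z(y)⁻¹ exp(-½ ‖C^{-1/2}(y - F(θ))‖²)` with
respect to the prior `μ₀`. -/
def bayesMeasure {M : ℕ} (F : Param → Data M) (σ : ℝ) (μ₀ : Measure Param) (y : Data M) :
    Measure Param :=
  (evidence F σ μ₀ y)⁻¹ • μ₀.withDensity fun θ => ENNReal.ofReal (likelihood F σ y θ)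

/-- `K` is a (regular) conditional distribution of `X` given `Y` under `P`. -/
def IsConditionalLaw {S A B : Type*} [MeasurableSpace S] [MeasurableSpace A] [MeasurableSpace B]
    (P : Measure S) (X : S → A) (Y : S → B) (K : Kernel B A) : Prop :=
  P.map (fun s => (Y s, X s)) = (P.map Y) ⊗ₘ K

/-- Hellinger distance, `d(μ,ν)² = ½ ∫ (√(dμ/dλ) - √(dν/dλ))² dλ` with `λ = μ + ν`. -/
def hellingerDist {A : Type*} [MeasurableSpace A] (μ ν : Measure A) : ℝ :=
  Real.sqrt (1 / 2 * ∫ x, (Real.sqrt (μ.rnDeriv (μ + ν) x).toReal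
    - Real.sqrt (ν.rnDeriv (μ + ν) x).toReal) ^ 2 ∂(μ + ν))

end Torsion

end

/-!
The weak solution is a minimizer of the convex energy of the problem. Minimizing over functions
vanishing outside `Ω` with a fixed Lipschitz bound gives a variational inequality; linear barriers
over the convex set `Ω`, comparison and translation bound the gradient of the minimizer
independently of the constraint (Hartman–Stampacchia), so for a large Lipschitz bound the
constraint is inactive and the minimizer is a weak solution. Since its gradient is bounded, strong
monotonicity of the flux against it yields uniqueness in all of `H¹₀` and continuity in `θ`.

With `F` continuous, the pair (data, parameter) has density proportional to the likelihood with
respect to Lebesgue measure times the prior, which is Bayes' rule. The square root of the Gaussian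
likelihood is globally Lipschitz in the data and the evidence is bounded below on balls, so the
square roots of the posterior densities are Lipschitz in the data, uniformly in the parameter.
-/

noncomputable section

namespace Torsion

open Filter Topology Set Metric
open scoped NNReal Gradient Convolution

section LipschitzOperations

variable {E : Type*} [NormedAddCommGroup E] {f : E → ℝ} {K : ℝ≥0}

theorem lipschitzWith_posPart (hf : LipschitzWith K f) : LipschitzWith K f⁺ := hf.max_const 0

theorem lipschitzWith_comp_add_right (hf : LipschitzWith K f) (h : E) :
    LipschitzWith K (fun x => f (x + h)) :=
  LipschitzWith.of_dist_le_mul fun x y => by simpa using hf.dist_le_mul (x + h) (y + h)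

theorem lipschitzWith_add_const (hf : LipschitzWith K f) (t : ℝ) :
    LipschitzWith K (fun x => f x + t) :=
  LipschitzWith.of_dist_le_mul fun x y => by simpa using hf.dist_le_mul x y

theorem lipschitzWith_const_smul (hf : LipschitzWith K f) (t : ℝ) :
    LipschitzWith (‖t‖₊ * K) (t • f) :=
  (lipschitzWith_smul t).comp hf

theorem lipschitzWith_sq {B : ℝ≥0} (hf : LipschitzWith K f) (hB : ∀ x, |f x| ≤ B) :
    LipschitzWith (2 * B * K) (f ^ 2) := by
  refine LipschitzWith.of_dist_le_mul fun x y => ?_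
  have hsum : |f x + f y| ≤ 2 * B := (abs_add_le _ _).trans (by linarith [hB x, hB y])
  calc dist ((f ^ 2) x) ((f ^ 2) y) = |f x + f y| * dist (f x) (f y) := by
        rw [Real.dist_eq, Real.dist_eq, Pi.pow_apply, Pi.pow_apply, sq_sub_sq, abs_mul]
    _ ≤ 2 * B * (K * dist x y) := by
        gcongr
        exact hf.dist_le_mul x y
    _ = (2 * B * K : ℝ≥0) * dist x y := by push_cast; ring

theorem lipschitzWith_limsup {w : ℕ → E → ℝ} {B : ℝ} (hw : ∀ n, LipschitzWith K (w n))
    (hB : ∀ n x, |w n x| ≤ B) : LipschitzWith K fun x => limsup (fun n => w n x) atTop := by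
  have hle (x : E) : IsBoundedUnder (· ≤ ·) atTop fun n => w n x :=
    isBoundedUnder_of ⟨B, fun n => (abs_le.1 (hB n x)).2⟩
  have hge (x : E) : IsBoundedUnder (· ≥ ·) atTop fun n => w n x :=
    isBoundedUnder_of ⟨-B, fun n => (abs_le.1 (hB n x)).1⟩
  refine LipschitzWith.of_le_add_mul K fun x y => ?_
  rw [← limsup_add_const atTop (fun n => w n y) (K * dist x y) (hle y) (hge y).isCoboundedUnder_le]
  exact limsup_le_limsup (.of_forall fun n => (hw n).le_add_mul x y)
    (hge x).isCoboundedUnder_le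
    (isBoundedUnder_of ⟨B + K * dist x y, fun n => by gcongr; exact (abs_le.1 (hB n y)).2⟩)

end LipschitzOperations

section GradientCalculus

variable {E : Type*} [NormedAddCommGroup E] [InnerProductSpace ℝ E] [CompleteSpace E]
  {f g : E → ℝ} {K C : ℝ≥0} {x : E}

theorem norm_gradient_le (hf : LipschitzWith K f) (x : E) : ‖∇ f x‖ ≤ K := by
  rw [gradient, LinearIsometryEquiv.norm_map]
  exact norm_fderiv_le_of_lipschitz ℝ hf

theorem measurable_gradient [MeasurableSpace E] [BorelSpace E] (f : E → ℝ) :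
    Measurable (∇ f) :=
  (InnerProductSpace.toDual ℝ E).symm.continuous.measurable.comp (measurable_fderiv ℝ f)

theorem gradient_add (hf : DifferentiableAt ℝ f x) (hg : DifferentiableAt ℝ g x) :
    ∇ (f + g) x = ∇ f x + ∇ g x := by
  simp only [gradient, fderiv_add hf hg, map_add]

theorem gradient_sub (hf : DifferentiableAt ℝ f x) (hg : DifferentiableAt ℝ g x) :
    ∇ (f - g) x = ∇ f x - ∇ g x := by
  simp only [gradient, fderiv_sub hf hg, map_sub]

theorem gradient_const_smul (t : ℝ) (f : E → ℝ) (x : E) : ∇ (t • f) x = t • ∇ f x := by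
  simp only [gradient, fderiv_const_smul_field, Pi.smul_apply, map_smulₛₗ, conj_trivial]

theorem gradient_neg (f : E → ℝ) (x : E) : ∇ (-f) x = -∇ f x := by
  simp only [gradient, fderiv_neg, map_neg]

theorem gradient_pow_two (hf : DifferentiableAt ℝ f x) : ∇ (f ^ 2) x = (2 * f x) • ∇ f x := by
  simp [gradient, fderiv_pow 2 hf]

theorem gradient_add_const (f : E → ℝ) (t : ℝ) : ∇ (fun x => f x + t) = ∇ f := by
  ext1 x
  simp only [gradient, fderiv_add_const]

theorem gradient_comp_add_right (f : E → ℝ) (h x : E) :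
    ∇ (fun x => f (x + h)) x = ∇ f (x + h) := by
  simp only [gradient, fderiv_comp_add_right]

theorem gradient_inner_left (e x : E) : ∇ (fun x => inner ℝ e x) x = e :=
  HasGradientAt.gradient (innerSL ℝ e).hasFDerivAt

/-- At a zero of `f` the function `f⁺` is minimal, so the formula needs no differentiability. -/
theorem gradient_posPart (hf : Continuous f) (x : E) :
    ∇ f⁺ x = {x | 0 < f x}.indicator (∇ f) x := by
  rcases lt_trichotomy (f x) 0 with h | h | h
  · have : f⁺ =ᶠ[𝓝 x] fun _ => 0 := by
      filter_upwards [hf.continuousAt.eventually_lt_const h] with y hy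
      exact max_eq_right hy.le
    simp [this.gradient_eq, h.not_gt]
  · have hmin : IsLocalMin f⁺ x :=
      .of_forall fun y => by simp [posPart_def, h]
    simp [gradient, hmin.fderiv_eq_zero, h]
  · have : f⁺ =ᶠ[𝓝 x] f := by
      filter_upwards [hf.continuousAt.eventually_const_lt h] with y hy
      exact max_eq_left hy.le
    simp [this.gradient_eq, h]

end GradientCalculus

section LipschitzIntegrals

variable {E : Type*} [NormedAddCommGroup E] [InnerProductSpace ℝ E] [FiniteDimensional ℝ E]
  [MeasureSpace E] [BorelSpace E] [(volume : Measure E).IsAddHaarMeasure]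
  {f g : E → ℝ} {K C : ℝ≥0}

theorem ae_gradient_eq_zero_of_eq_zero (hf : LipschitzWith K f) :
    ∀ᵐ x, f x = 0 → ∇ f x = 0 := by
  filter_upwards [(lipschitzWith_posPart hf).ae_differentiableAt (μ := volume),
    (lipschitzWith_posPart hf.neg).ae_differentiableAt (μ := volume)] with x hp hn hx
  have h : f = f⁺ - (-f)⁺ := by
    rw [posPart_neg, posPart_sub_negPart]
  rw [h, gradient_sub hp hn, gradient_posPart hf.continuous, gradient_posPart hf.continuous.neg]
  simp [hx]

theorem ae_lineDeriv_eq_inner_gradient (hf : LipschitzWith K f) (e : E) :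
    ∀ᵐ x, lineDeriv ℝ f x e = inner ℝ (∇ f x) e := by
  filter_upwards [hf.ae_differentiableAt (μ := volume)] with x hx
  rw [hx.lineDeriv_eq_fderiv, inner_gradient_left]

theorem integral_inner_gradient_mul (hf : LipschitzWith K f) (hg : LipschitzWith C g)
    (hgc : HasCompactSupport g) (e : E) :
    ∫ x, inner ℝ (∇ f x) e * g x = -∫ x, f x * inner ℝ (∇ g x) e :=
  calc ∫ x, inner ℝ (∇ f x) e * g x = ∫ x, lineDeriv ℝ f x e * g x := by
        refine integral_congr_ae ?_
        filter_upwards [ae_lineDeriv_eq_inner_gradient hf e] with x hx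
        rw [hx]
    _ = ∫ x, lineDeriv ℝ g x (-e) * f x :=
        LipschitzWith.integral_lineDeriv_mul_eq hf hg hgc e
    _ = -∫ x, f x * inner ℝ (∇ g x) e := by
        rw [← integral_neg]
        refine integral_congr_ae ?_
        filter_upwards [ae_lineDeriv_eq_inner_gradient hg (-e)] with x hx
        rw [hx, inner_neg_right, neg_mul, mul_comm]

theorem integral_inner_mul_inner_gradient {e : E} (he : ‖e‖ = 1) (m : ℝ) (hg : LipschitzWith C g)
    (hgc : HasCompactSupport g) :
    ∫ x, (inner ℝ e x - m) * inner ℝ (∇ g x) e = -∫ x, g x := by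
  have h := integral_inner_gradient_mul
    ((innerSL ℝ e).lipschitz.sub (LipschitzWith.const' (K := 0) m)) hg hgc e
  rw [← neg_eq_iff_eq_neg, eq_comm] at h
  simpa [sub_eq_add_neg, gradient_add_const, gradient_inner_left, he] using h

end LipschitzIntegrals

section Dominated

variable {α F : Type*} [MeasurableSpace α] {μ : Measure α} [NormedAddCommGroup F] {s : Set α}

theorem integrable_of_bound_of_eq_zero {f : α → F} (hs : μ s ≠ ⊤)
    (hf : AEStronglyMeasurable f μ) {C : ℝ} (hC : ∀ x, ‖f x‖ ≤ C)
    (h0 : ∀ᵐ x ∂μ, x ∉ s → f x = 0) : Integrable f μ :=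
  (IntegrableOn.of_bound hs.lt_top hf.restrict C
    (.of_forall hC)).integrable_of_ae_notMem_eq_zero h0

theorem tendsto_integral_of_bound_of_eq_zero [NormedSpace ℝ F] {w : ℕ → α → F} {f : α → F}
    (hs : μ s ≠ ⊤) (hw : ∀ n, AEStronglyMeasurable (w n) μ) {C : ℝ} (hC : ∀ n x, ‖w n x‖ ≤ C)
    (h0 : ∀ n, ∀ᵐ x ∂μ, x ∉ s → w n x = 0)
    (hlim : ∀ᵐ x ∂μ, Tendsto (fun n => w n x) atTop (𝓝 (f x))) :
    Tendsto (fun n => ∫ x, w n x ∂μ) atTop (𝓝 (∫ x, f x ∂μ)) := by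
  refine tendsto_integral_of_dominated_convergence ((toMeasurable μ s).indicator fun _ => C) hw
    ?_ (fun n => ?_) hlim
  · exact (integrable_indicator_iff (measurableSet_toMeasurable μ s)).2
      (integrableOn_const (by rwa [measure_toMeasurable]))
  · filter_upwards [h0 n] with x h
    by_cases hx : x ∈ toMeasurable μ s
    · simpa [hx] using hC n x
    · simp [hx, h fun hxs => hx (subset_toMeasurable μ s hxs)]

end Dominated

/-- The `K`-Lipschitz functions that vanish outside `Ω`. They replace `W^{1,∞}` functions with zero
boundary values, without any trace theory. -/
structure VanishingLip {E : Type*} [PseudoEMetricSpace E] (Ω : Set E) (K : ℝ≥0) (f : E → ℝ) :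
    Prop where
  lip : LipschitzWith K f
  zero : ∀ x ∉ Ω, f x = 0

namespace VanishingLip

section Lattice

variable {E : Type*} [NormedAddCommGroup E] {Ω : Set E} {f g : E → ℝ} {K C : ℝ≥0} {R : ℝ}

theorem mono (hf : VanishingLip Ω K f) (hKC : K ≤ C) : VanishingLip Ω C f :=
  ⟨hf.lip.weaken hKC, hf.zero⟩

theorem add (hf : VanishingLip Ω K f) (hg : VanishingLip Ω C g) :
    VanishingLip Ω (K + C) (f + g) :=
  ⟨hf.lip.add hg.lip, fun x hx => by simp [hf.zero x hx, hg.zero x hx]⟩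

theorem sub (hf : VanishingLip Ω K f) (hg : VanishingLip Ω C g) :
    VanishingLip Ω (K + C) (f - g) :=
  ⟨hf.lip.sub hg.lip, fun x hx => by simp [hf.zero x hx, hg.zero x hx]⟩

theorem neg (hf : VanishingLip Ω K f) : VanishingLip Ω K (-f) :=
  ⟨hf.lip.neg, fun x hx => by simp [hf.zero x hx]⟩

theorem const_smul (hf : VanishingLip Ω K f) (t : ℝ) : VanishingLip Ω (‖t‖₊ * K) (t • f) :=
  ⟨lipschitzWith_const_smul hf.lip t, fun x hx => by simp [hf.zero x hx]⟩

theorem add_smul_sub (hf : VanishingLip Ω K f) (hg : VanishingLip Ω K g) {t : ℝ}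
    (ht : t ∈ Icc (0 : ℝ) 1) : VanishingLip Ω K (f + t • (g - f)) := by
  have hK : ‖1 - t‖₊ * K + ‖t‖₊ * K = K := by
    ext
    simp [abs_of_nonneg ht.1, abs_of_nonneg (sub_nonneg.2 ht.2), ← add_mul]
  have h := (hf.const_smul (1 - t)).add (hg.const_smul t)
  rw [hK] at h
  convert! h using 1
  module

theorem posPart_sub (hf : LipschitzWith K f) (hg : LipschitzWith C g)
    (h : ∀ x ∉ Ω, f x ≤ g x) : VanishingLip Ω (K + C) (f - g)⁺ :=
  ⟨lipschitzWith_posPart (hf.sub hg), fun x hx => max_eq_right (sub_nonpos.2 (h x hx))⟩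

theorem abs_le [NormedSpace ℝ E] [Nontrivial E] (hR : 0 ≤ R) (hΩ : Ω ⊆ ball 0 R)
    (hf : VanishingLip Ω K f) (x : E) : |f x| ≤ K * (2 * R) := by
  by_cases hx : x ∈ Ω
  · have hxR : ‖x‖ < R := by simpa using hΩ hx
    obtain ⟨y, hy⟩ := exists_norm_eq E hR
    have hfy : f y = 0 := hf.zero y fun h => by simpa [hy] using hΩ h
    calc |f x| = dist (f x) (f y) := by rw [hfy, Real.dist_eq, sub_zero]
      _ ≤ K * dist x y := hf.lip.dist_le_mul x y
      _ ≤ K * (2 * R) := by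
          gcongr
          linarith [dist_le_norm_add_norm x y]
  · rw [hf.zero x hx, abs_zero]
    positivity

end Lattice

section Pointwise

variable {E : Type*} [NormedAddCommGroup E] {Ω : Set E} {f : E → ℝ} {K : ℝ≥0} {R : ℝ}

theorem hasCompactSupport [ProperSpace E] (hΩ : Bornology.IsBounded Ω) (hf : VanishingLip Ω K f) :
    HasCompactSupport f :=
  HasCompactSupport.intro hΩ.isCompact_closure fun x hx => hf.zero x fun h => hx (subset_closure h)

theorem hasCompactSupport_sq [ProperSpace E] (hΩ : Bornology.IsBounded Ω)
    (hf : VanishingLip Ω K f) : HasCompactSupport (f ^ 2) :=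
  (hf.hasCompactSupport hΩ).comp_left (zero_pow two_ne_zero)

theorem abs_inner_mul_inner_gradient_sq_le [InnerProductSpace ℝ E] [CompleteSpace E]
    (hΩ : Ω ⊆ ball 0 R) (hf : VanishingLip Ω K f) {e x : E} (he : ‖e‖ = 1)
    (hx : DifferentiableAt ℝ f x) :
    |inner ℝ e x * inner ℝ (∇ (f ^ 2) x) e| ≤ 1 / 2 * f x ^ 2 + 2 * R ^ 2 * ‖∇ f x‖ ^ 2 := by
  rw [gradient_pow_two hx, real_inner_smul_left]
  by_cases hxΩ : x ∈ Ω
  · have hex : |inner ℝ e x| ≤ |R| := by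
      refine (abs_real_inner_le_norm e x).trans ?_
      rw [he, one_mul]
      exact (mem_ball_zero_iff.1 (hΩ hxΩ)).le.trans (le_abs_self R)
    have hde : |inner ℝ (∇ f x) e| ≤ |‖∇ f x‖| := by
      simpa [he] using abs_real_inner_le_norm (∇ f x) e
    have hprod : (inner ℝ e x * inner ℝ (∇ f x) e) ^ 2 ≤ R ^ 2 * ‖∇ f x‖ ^ 2 := by
      rw [mul_pow]
      exact mul_le_mul (sq_le_sq.2 hex) (sq_le_sq.2 hde) (sq_nonneg _) (sq_nonneg _)
    rw [mul_left_comm, _root_.abs_le]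
    constructor
    · linarith [sq_nonneg (f x + 2 * (inner ℝ e x * inner ℝ (∇ f x) e))]
    · linarith [sq_nonneg (f x - 2 * (inner ℝ e x * inner ℝ (∇ f x) e))]
  · rw [hf.zero x hxΩ]
    simp only [mul_zero, zero_mul, abs_zero]
    positivity

end Pointwise

section Integrals

variable {E : Type*} [NormedAddCommGroup E] [InnerProductSpace ℝ E] [FiniteDimensional ℝ E]
  [MeasureSpace E] [BorelSpace E] [(volume : Measure E).IsAddHaarMeasure]
  {Ω : Set E} {f : E → ℝ} {K : ℝ≥0} {R : ℝ}

theorem integrable (hΩ : Bornology.IsBounded Ω) (hf : VanishingLip Ω K f) : Integrable f :=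
  hf.lip.continuous.integrable_of_hasCompactSupport (hf.hasCompactSupport hΩ)

theorem integrable_sq (hΩ : Bornology.IsBounded Ω) (hf : VanishingLip Ω K f) :
    Integrable fun x => f x ^ 2 :=
  (hf.lip.continuous.pow 2).integrable_of_hasCompactSupport (hf.hasCompactSupport_sq hΩ)

theorem ae_gradient_eq_zero (hf : VanishingLip Ω K f) : ∀ᵐ x, x ∉ Ω → ∇ f x = 0 := by
  filter_upwards [ae_gradient_eq_zero_of_eq_zero hf.lip] with x hx h using hx (hf.zero x h)

theorem integrable_norm_gradient_sq (hΩ : Bornology.IsBounded Ω) (hf : VanishingLip Ω K f) :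
    Integrable fun x => ‖∇ f x‖ ^ 2 := by
  refine integrable_of_bound_of_eq_zero (C := K ^ 2) hΩ.measure_lt_top.ne
    ((measurable_gradient f).norm.pow_const 2).aestronglyMeasurable (fun x => ?_) ?_
  · rw [norm_pow, norm_norm]
    gcongr
    exact norm_gradient_le hf.lip x
  · filter_upwards [hf.ae_gradient_eq_zero] with x hx h
    simp [hx h]

/-- Uses `∫ f² = -∫ ⟨e, x⟩ ⟨∇(f²), e⟩` for a unit vector `e`. -/
theorem integral_sq_le [Nontrivial E] (hR : 0 ≤ R) (hΩ : Ω ⊆ ball 0 R)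
    (hf : VanishingLip Ω K f) : ∫ x, f x ^ 2 ≤ 4 * R ^ 2 * ∫ x, ‖∇ f x‖ ^ 2 := by
  have hΩb : Bornology.IsBounded Ω := isBounded_ball.subset hΩ
  obtain ⟨e, he⟩ := exists_norm_eq E zero_le_one
  have hsq : LipschitzWith (2 * (K * (2 * R.toNNReal)) * K) (f ^ 2) :=
    lipschitzWith_sq hf.lip fun x => by simpa [hR] using hf.abs_le hR hΩ x
  have hint : Integrable fun x => 1 / 2 * f x ^ 2 + 2 * R ^ 2 * ‖∇ f x‖ ^ 2 :=
    ((hf.integrable_sq hΩb).const_mul _).add ((hf.integrable_norm_gradient_sq hΩb).const_mul _)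
  have hle : ∫ x, f x ^ 2 ≤ ∫ x, (1 / 2 * f x ^ 2 + 2 * R ^ 2 * ‖∇ f x‖ ^ 2) := by
    calc ∫ x, f x ^ 2 = -∫ x, inner ℝ e x * inner ℝ (∇ (f ^ 2) x) e := by
          have h := integral_inner_mul_inner_gradient he 0 hsq (hf.hasCompactSupport_sq hΩb)
          simp only [sub_zero] at h
          rw [h, neg_neg]
          rfl
      _ ≤ ‖∫ x, inner ℝ e x * inner ℝ (∇ (f ^ 2) x) e‖ := neg_le_abs _
      _ ≤ _ := by
          refine norm_integral_le_of_norm_le hint ?_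
          filter_upwards [hf.lip.ae_differentiableAt (μ := volume)] with x hx
          exact hf.abs_inner_mul_inner_gradient_sq_le hΩ he hx
  rw [integral_add ((hf.integrable_sq hΩb).const_mul _)
    ((hf.integrable_norm_gradient_sq hΩb).const_mul _), integral_const_mul,
    integral_const_mul] at hle
  linarith

theorem eq_zero_of_gradient_ae_eq_zero [Nontrivial E] (hΩ : Bornology.IsBounded Ω)
    (hf : VanishingLip Ω K f) (h : ∀ᵐ x, ∇ f x = 0) : f = 0 := by
  obtain ⟨R, hR, hΩR⟩ := hΩ.subset_ball_lt 0 0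
  have hgrad : ∫ x, ‖∇ f x‖ ^ 2 = 0 :=
    integral_eq_zero_of_ae (by filter_upwards [h] with x hx using by simp [hx])
  have hsq : ∫ x, f x ^ 2 = 0 := by
    refine le_antisymm ?_ (integral_nonneg fun x => sq_nonneg _)
    simpa [hgrad] using hf.integral_sq_le hR.le hΩR
  rw [integral_eq_zero_iff_of_nonneg (fun x => sq_nonneg _) (hf.integrable_sq hΩ)] at hsq
  exact eq_zero_of_pow_eq_zero
    ((Continuous.ae_eq_iff_eq volume (hf.lip.continuous.pow 2) continuous_const).1 hsq)

end Integrals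

end VanishingLip

/-- A continuous nondecreasing stiffness `s ↦ g(s)`, evaluated at `s = |∇u|²`, with the positive
lower bound `c` that makes the equation coercive. -/
structure IsStiffness (g : ℝ → ℝ) (c : ℝ) : Prop where
  pos : 0 < c
  cont : Continuous g
  mono : Monotone g
  le : ∀ s, c ≤ g s

section Density

variable {E : Type*} [NormedAddCommGroup E] {g : ℝ → ℝ} {c K : ℝ} {p q : E}

/-- The energy density `½ ∫₀^{|p|²} g`, a potential of the flux. -/
def energyDensity (g : ℝ → ℝ) (p : E) : ℝ := (∫ s in (0 : ℝ)..‖p‖ ^ 2, g s) / 2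

@[simp] theorem energyDensity_zero (g : ℝ → ℝ) : energyDensity g (0 : E) = 0 := by
  simp [energyDensity]

theorem IsStiffness.continuous_energyDensity (hg : IsStiffness g c) :
    Continuous (energyDensity g : E → ℝ) := by
  have h : Continuous fun t => ∫ s in (0 : ℝ)..t, g s :=
    intervalIntegral.continuous_primitive (fun _ _ => hg.cont.intervalIntegrable _ _) 0
  exact (h.comp (continuous_norm.pow 2)).div_const 2

variable [InnerProductSpace ℝ E]

/-- The flux of the equation `-div (g(|∇u|²) ∇u) = f` as a function of the gradient `p`. -/
def flux (g : ℝ → ℝ) (p : E) : E := g (‖p‖ ^ 2) • p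

@[simp] theorem flux_zero (g : ℝ → ℝ) : flux g (0 : E) = 0 := by simp [flux]

namespace IsStiffness

theorem nonneg (hg : IsStiffness g c) (s : ℝ) : 0 ≤ g s := hg.pos.le.trans (hg.le s)

theorem continuous_flux (hg : IsStiffness g c) : Continuous (flux g : E → E) :=
  (hg.cont.comp (continuous_norm.pow 2)).smul continuous_id

theorem norm_flux_le (hg : IsStiffness g c) (hp : ‖p‖ ≤ K) : ‖flux g p‖ ≤ g (K ^ 2) * K := by
  rw [flux, norm_smul, Real.norm_of_nonneg (hg.nonneg _)]
  exact mul_le_mul (hg.mono (by gcongr)) hp (norm_nonneg _) (hg.nonneg _)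

theorem mul_sub_le_integral (hg : IsStiffness g c) (s t : ℝ) :
    g s * (t - s) ≤ ∫ x in s..t, g x := by
  rcases le_total s t with h | h
  · have := intervalIntegral.integral_mono_on (μ := volume) (f := fun _ => g s) h
      intervalIntegrable_const (hg.cont.intervalIntegrable s t) fun x hx => hg.mono hx.1
    simpa [mul_comm] using this
  · have := intervalIntegral.integral_mono_on (μ := volume) (g := fun _ => g s) h
      (hg.cont.intervalIntegrable t s) intervalIntegrable_const fun x hx => hg.mono hx.2
    rw [intervalIntegral.integral_const, smul_eq_mul] at this
    rw [intervalIntegral.integral_symm]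
    linarith

theorem energyDensity_add_inner_flux_le (hg : IsStiffness g c) (p q : E) :
    energyDensity g p + inner ℝ (flux g p) (q - p) + c / 2 * ‖q - p‖ ^ 2 ≤ energyDensity g q := by
  have hint := hg.mul_sub_le_integral (‖p‖ ^ 2) (‖q‖ ^ 2)
  have hadd := intervalIntegral.integral_add_adjacent_intervals
    (hg.cont.intervalIntegrable (μ := volume) 0 (‖p‖ ^ 2))
    (hg.cont.intervalIntegrable (μ := volume) (‖p‖ ^ 2) (‖q‖ ^ 2))
  have hq : ‖q‖ ^ 2 = ‖p‖ ^ 2 + 2 * inner ℝ p (q - p) + ‖q - p‖ ^ 2 := by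
    rw [← norm_add_sq_real, add_sub_cancel]
  rw [flux, real_inner_smul_left, energyDensity, energyDensity]
  rw [hq] at hint hadd ⊢
  linarith [mul_le_mul_of_nonneg_right (hg.le (‖p‖ ^ 2)) (sq_nonneg ‖q - p‖)]

theorem energyDensity_nonneg (hg : IsStiffness g c) (p : E) : 0 ≤ energyDensity g p := by
  have h := hg.energyDensity_add_inner_flux_le 0 p
  have hc := hg.pos
  simp only [energyDensity_zero, flux_zero, inner_zero_left, sub_zero, zero_add] at h
  exact h.trans' (by positivity)

theorem energyDensity_le (hg : IsStiffness g c) (hp : ‖p‖ ≤ K) :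
    energyDensity g p ≤ g (K ^ 2) * K * K := by
  have h := hg.energyDensity_add_inner_flux_le p 0
  have hc : 0 ≤ c / 2 * ‖0 - p‖ ^ 2 := mul_nonneg (half_pos hg.pos).le (sq_nonneg _)
  have hflux : inner ℝ (flux g p) p ≤ g (K ^ 2) * K * K :=
    (real_inner_le_norm _ _).trans (mul_le_mul (hg.norm_flux_le hp) hp (norm_nonneg _)
      ((norm_nonneg _).trans (hg.norm_flux_le hp)))
  rw [energyDensity_zero, zero_sub, inner_neg_right] at h
  rw [zero_sub] at hc
  linarith

/-- Strong monotonicity is the sum of the strong convexity inequalities at `p` and at `q`. -/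
theorem mul_norm_sub_sq_le_inner_flux_sub (hg : IsStiffness g c) (p q : E) :
    c * ‖p - q‖ ^ 2 ≤ inner ℝ (flux g p - flux g q) (p - q) := by
  have hp := hg.energyDensity_add_inner_flux_le p q
  have hq := hg.energyDensity_add_inner_flux_le q p
  rw [norm_sub_rev q p, ← neg_sub p q, inner_neg_right] at hp
  rw [inner_sub_left]
  linarith

theorem energyDensity_midpoint_le (hg : IsStiffness g c) (p q : E) :
    energyDensity g (p + (1 / 2 : ℝ) • (q - p)) + c / 8 * ‖q - p‖ ^ 2 ≤
      (energyDensity g p + energyDensity g q) / 2 := by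
  have hp := hg.energyDensity_add_inner_flux_le (p + (1 / 2 : ℝ) • (q - p)) p
  have hq := hg.energyDensity_add_inner_flux_le (p + (1 / 2 : ℝ) • (q - p)) q
  rw [show p - (p + (1 / 2 : ℝ) • (q - p)) = -((1 / 2 : ℝ) • (q - p)) by module,
    inner_neg_right, norm_neg] at hp
  rw [show q - (p + (1 / 2 : ℝ) • (q - p)) = (1 / 2 : ℝ) • (q - p) by module] at hq
  rw [norm_smul, Real.norm_of_nonneg one_half_pos.le] at hp hq
  linarith

end IsStiffness

end Density

section Limits

variable {α F : Type*} [MeasurableSpace α] {μ : Measure α}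
  [NormedAddCommGroup F] [InnerProductSpace ℝ F]

theorem norm_toLp_sq {w : α → F} (hw : MemLp w 2 μ) :
    ‖hw.toLp w‖ ^ 2 = ∫ x, ‖w x‖ ^ 2 ∂μ := by
  rw [← real_inner_self_eq_norm_sq, L2.inner_def]
  refine integral_congr_ae ?_
  filter_upwards [hw.coeFn_toLp] with x hx
  rw [hx, real_inner_self_eq_norm_sq]

theorem exists_subseq_tendsto_ae_of_integral_norm_sub_sq_le [CompleteSpace F] {w : ℕ → α → F}
    (hw : ∀ n, MemLp (w n) 2 μ) {ε : ℕ → ℝ} (hε : Tendsto ε atTop (𝓝 0))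
    (h : ∀ N n k, N ≤ n → N ≤ k → ∫ x, ‖w n x - w k x‖ ^ 2 ∂μ ≤ ε N) :
    ∃ ns : ℕ → ℕ, StrictMono ns ∧
      ∀ᵐ x ∂μ, ∃ l, Tendsto (fun n => w (ns n) x) atTop (𝓝 l) := by
  have hcauchy : CauchySeq fun n => (hw n).toLp (w n) := by
    refine cauchySeq_of_le_tendsto_0 (fun n => √(ε n)) (fun n k N hn hk => ?_)
      (by simpa using hε.sqrt)
    rw [dist_eq_norm, ← MemLp.toLp_sub]
    exact Real.le_sqrt_of_sq_le ((norm_toLp_sq _).trans_le (h N n k hn hk))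
  obtain ⟨W, hW⟩ := cauchySeq_tendsto_of_complete hcauchy
  obtain ⟨ns, hns, hlim⟩ := (tendstoInMeasure_of_tendsto_Lp hW).exists_seq_tendsto_ae
  refine ⟨ns, hns, ?_⟩
  filter_upwards [hlim, ae_all_iff.2 fun n => (hw n).coeFn_toLp] with x hx hw
  exact ⟨W x, hx.congr fun n => hw _⟩

end Limits

section GradientLimits

variable {E : Type*} [NormedAddCommGroup E] [InnerProductSpace ℝ E] [FiniteDimensional ℝ E]
  [MeasureSpace E] [BorelSpace E] [(volume : Measure E).IsAddHaarMeasure]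
  {Ω : Set E} {g : ℝ → ℝ} {c f : ℝ} {K C : ℝ≥0} {u v : E → ℝ}
  {w : ℕ → E → ℝ} {q : E → E}

namespace VanishingLip

theorem memLp (hΩ : Bornology.IsBounded Ω) (hu : VanishingLip Ω K u) : MemLp u 2 :=
  (memLp_two_iff_integrable_sq hu.lip.continuous.aestronglyMeasurable).2 (hu.integrable_sq hΩ)

theorem memLp_gradient (hΩ : Bornology.IsBounded Ω) (hu : VanishingLip Ω K u) :
    MemLp (∇ u) 2 :=
  (memLp_two_iff_integrable_sq_norm (measurable_gradient u).aestronglyMeasurable).2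
    (hu.integrable_norm_gradient_sq hΩ)

theorem tendsto_integral_mul_inner_gradient [Nontrivial E] (hΩ : Bornology.IsBounded Ω)
    (hw : ∀ n, VanishingLip Ω K (w n)) (hlim : ∀ᵐ x, Tendsto (fun n => w n x) atTop (𝓝 (u x)))
    {ψ : E → ℝ} (hψ : LipschitzWith C ψ) (e : E) :
    Tendsto (fun n => ∫ x, w n x * inner ℝ (∇ ψ x) e) atTop
      (𝓝 (∫ x, u x * inner ℝ (∇ ψ x) e)) := by
  obtain ⟨R, hR, hΩR⟩ := hΩ.subset_ball_lt 0 0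
  refine tendsto_integral_of_bound_of_eq_zero (C := K * (2 * R) * (C * ‖e‖))
    hΩ.measure_lt_top.ne (fun n => ?_) (fun n x => ?_) (fun n => ?_) ?_
  · exact (hw n).lip.continuous.aestronglyMeasurable.mul
      ((measurable_gradient ψ).inner_const).aestronglyMeasurable
  · rw [norm_mul]
    gcongr
    · exact (hw n).abs_le hR.le hΩR x
    · exact (norm_inner_le_norm _ _).trans (by gcongr; exact norm_gradient_le hψ x)
  · exact .of_forall fun x hx => by simp [(hw n).zero x hx]
  · filter_upwards [hlim] with x hx using hx.mul_const _

theorem tendsto_integral_inner_gradient_mul (hΩ : Bornology.IsBounded Ω)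
    (hw : ∀ n, VanishingLip Ω K (w n)) (hlim : ∀ᵐ x, Tendsto (fun n => ∇ (w n) x) atTop (𝓝 (q x)))
    {ψ : E → ℝ} (hψ : Continuous ψ) {B : ℝ} (hB : ∀ x, ‖ψ x‖ ≤ B) (e : E) :
    Tendsto (fun n => ∫ x, inner ℝ (∇ (w n) x) e * ψ x) atTop
      (𝓝 (∫ x, inner ℝ (q x) e * ψ x)) := by
  refine tendsto_integral_of_bound_of_eq_zero (C := K * ‖e‖ * B)
    hΩ.measure_lt_top.ne (fun n => ?_) (fun n x => ?_) (fun n => ?_) ?_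
  · exact ((measurable_gradient _).inner_const).aestronglyMeasurable.mul hψ.aestronglyMeasurable
  · rw [norm_mul]
    gcongr
    · exact (norm_inner_le_norm _ _).trans (by gcongr; exact norm_gradient_le (hw n).lip x)
    · exact hB x
  · filter_upwards [(hw n).ae_gradient_eq_zero] with x hx h
    simp [hx h]
  · filter_upwards [hlim] with x hx using (hx.inner tendsto_const_nhds).mul_const _

theorem ae_eq_gradient_of_tendsto [Nontrivial E] (hΩ : Bornology.IsBounded Ω)
    (hw : ∀ n, VanishingLip Ω K (w n)) (hu : LipschitzWith K u) (hq : Measurable q)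
    (hwu : ∀ᵐ x, Tendsto (fun n => w n x) atTop (𝓝 (u x)))
    (hwq : ∀ᵐ x, Tendsto (fun n => ∇ (w n) x) atTop (𝓝 (q x))) :
    ∀ᵐ x, q x = ∇ u x := by
  have hqK : ∀ᵐ x, ‖q x‖ ≤ K := by
    filter_upwards [hwq] with x hx
    exact le_of_tendsto hx.norm (.of_forall fun n => norm_gradient_le (hw n).lip x)
  suffices h : q - ∇ u =ᵐ[volume] 0 by
    filter_upwards [h] with x hx using sub_eq_zero.1 hx
  refine ae_eq_zero_of_forall_inner (𝕜 := ℝ) fun e => ?_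
  have hloc {p : E → E} (hp : Measurable p) (hpK : ∀ᵐ x, ‖p x‖ ≤ K) :
      LocallyIntegrable fun x => inner ℝ (p x) e :=
    (memLp_top_of_bound hp.inner_const.aestronglyMeasurable (K * ‖e‖)
      (hpK.mono fun x hx => (norm_inner_le_norm _ _).trans (by gcongr))).locallyIntegrable le_top
  have hinner : ∀ᵐ x, inner ℝ (q x) e = inner ℝ (∇ u x) e := by
    refine ae_eq_of_integral_contDiff_smul_eq (hloc hq hqK)
      (hloc (measurable_gradient u) (.of_forall (norm_gradient_le hu))) fun ψ hψ hψc => ?_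
    obtain ⟨D, hψD⟩ : ∃ D, LipschitzWith D ψ :=
      ContDiff.lipschitzWith_of_hasCompactSupport hψc hψ (by simp)
    obtain ⟨B, hB⟩ := hψc.exists_bound_of_continuous hψ.continuous
    simp only [smul_eq_mul, mul_comm (ψ _)]
    rw [integral_inner_gradient_mul hu hψD hψc e]
    refine tendsto_nhds_unique
      (tendsto_integral_inner_gradient_mul hΩ hw hwq hψ.continuous hB e) ?_
    simp only [integral_inner_gradient_mul (hw _).lip hψD hψc e]
    exact (tendsto_integral_mul_inner_gradient hΩ hw hwu hψD e).neg
  filter_upwards [hinner] with x hx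
  rw [Pi.sub_apply, inner_sub_right, real_inner_comm, hx, real_inner_comm, sub_self, Pi.zero_apply]

theorem exists_tendsto_gradient_of_tendsto [Nontrivial E] (hΩ : Bornology.IsBounded Ω)
    (hw : ∀ n, VanishingLip Ω K (w n)) (hwu : ∀ᵐ x, ∃ l, Tendsto (fun n => w n x) atTop (𝓝 l))
    (hwq : ∀ᵐ x, ∃ l, Tendsto (fun n => ∇ (w n) x) atTop (𝓝 l)) :
    ∃ u, VanishingLip Ω K u ∧ (∀ᵐ x, Tendsto (fun n => w n x) atTop (𝓝 (u x))) ∧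
      ∀ᵐ x, Tendsto (fun n => ∇ (w n) x) atTop (𝓝 (∇ u x)) := by
  obtain ⟨R, hR, hΩR⟩ := hΩ.subset_ball_lt 0 0
  have hu : VanishingLip Ω K fun x => limsup (fun n => w n x) atTop :=
    ⟨lipschitzWith_limsup (fun n => (hw n).lip) fun n => (hw n).abs_le hR.le hΩR,
      fun x hx => by simp [(hw _).zero x hx]⟩
  have hlim : ∀ᵐ x, Tendsto (fun n => w n x) atTop (𝓝 (limsup (fun n => w n x) atTop)) := by
    filter_upwards [hwu] with x ⟨l, hl⟩
    rwa [hl.limsup_eq]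
  obtain ⟨q, hqm, hq⟩ := measurable_limit_of_tendsto_metrizable_ae
    (fun n => (measurable_gradient (w n)).aemeasurable) hwq
  refine ⟨_, hu, hlim, ?_⟩
  filter_upwards [hq, ae_eq_gradient_of_tendsto hΩ hw hu.lip hqm hlim hq] with x hx hqx
  rwa [← hqx]

theorem exists_subseq_tendsto_gradient [Nontrivial E] (hΩ : Bornology.IsBounded Ω)
    (hw : ∀ n, VanishingLip Ω K (w n)) {ε : ℕ → ℝ} (hε : Tendsto ε atTop (𝓝 0))
    (h : ∀ N n k, N ≤ n → N ≤ k → ∫ x, ‖∇ (w n - w k) x‖ ^ 2 ≤ ε N) :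
    ∃ u, VanishingLip Ω K u ∧ ∃ ns : ℕ → ℕ, StrictMono ns ∧
      (∀ᵐ x, Tendsto (fun n => w (ns n) x) atTop (𝓝 (u x))) ∧
      ∀ᵐ x, Tendsto (fun n => ∇ (w (ns n)) x) atTop (𝓝 (∇ u x)) := by
  obtain ⟨R, hR, hΩR⟩ := hΩ.subset_ball_lt 0 0
  have hgrad (n k) : ∫ x, ‖∇ (w n) x - ∇ (w k) x‖ ^ 2 = ∫ x, ‖∇ (w n - w k) x‖ ^ 2 := by
    refine integral_congr_ae ?_
    filter_upwards [(hw n).lip.ae_differentiableAt (μ := volume),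
      (hw k).lip.ae_differentiableAt (μ := volume)] with x hn hk
    rw [gradient_sub hn hk]
  obtain ⟨ns, hns, hlim⟩ := exists_subseq_tendsto_ae_of_integral_norm_sub_sq_le
    (fun n => (hw n).memLp_gradient hΩ) hε fun N n k hn hk => (hgrad n k).trans_le (h N n k hn hk)
  obtain ⟨ms, hms, hlim'⟩ := exists_subseq_tendsto_ae_of_integral_norm_sub_sq_le
    (fun n => (hw (ns n)).memLp hΩ) (ε := fun n => 4 * R ^ 2 * ε (ns n))
    (by simpa using (hε.comp hns.tendsto_atTop).const_mul (4 * R ^ 2)) fun N n k hn hk => by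
      simp only [Real.norm_eq_abs, sq_abs]
      refine (((hw _).sub (hw _)).integral_sq_le hR.le hΩR).trans ?_
      gcongr
      exact h _ _ _ (hns.monotone hn) (hns.monotone hk)
  obtain ⟨u, hu, huw, hup⟩ := exists_tendsto_gradient_of_tendsto hΩ (fun n => hw (ns (ms n)))
    hlim' (hlim.mono fun x ⟨l, hl⟩ => ⟨l, hl.comp hms.tendsto_atTop⟩)
  exact ⟨u, hu, ns ∘ ms, hns.comp hms, huw, hup⟩

end VanishingLip

end GradientLimits

section Flux

variable {E : Type*} [NormedAddCommGroup E] [InnerProductSpace ℝ E] {g : ℝ → ℝ} {c : ℝ}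
  {K C : ℝ≥0} {u v : E → ℝ}

theorem norm_inner_flux_gradient_le [CompleteSpace E] (hg : IsStiffness g c)
    (hu : LipschitzWith C u) (hv : LipschitzWith K v) (x : E) :
    ‖inner ℝ (flux g (∇ u x)) (∇ v x)‖ ≤ g (C ^ 2) * C * K :=
  (norm_inner_le_norm _ _).trans <| mul_le_mul (hg.norm_flux_le (norm_gradient_le hu x))
    (norm_gradient_le hv x) (norm_nonneg _) (mul_nonneg (hg.nonneg _) C.2)

variable [FiniteDimensional ℝ E] [MeasurableSpace E] [BorelSpace E]

theorem measurable_flux_gradient (hg : IsStiffness g c) (u : E → ℝ) :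
    Measurable fun x => flux g (∇ u x) :=
  hg.continuous_flux.measurable.comp (measurable_gradient u)

theorem aestronglyMeasurable_inner_flux_gradient (hg : IsStiffness g c) (u v : E → ℝ)
    (μ : Measure E) :
    AEStronglyMeasurable (fun x => inner ℝ (flux g (∇ u x)) (∇ v x)) μ :=
  ((measurable_flux_gradient hg u).inner (measurable_gradient v)).aestronglyMeasurable

end Flux

section VariationalInequality

variable {E : Type*} [NormedAddCommGroup E] [InnerProductSpace ℝ E] [CompleteSpace E]
  [MeasureSpace E] {Ω : Set E} {g : ℝ → ℝ} {f : ℝ} {K L D : ℝ≥0} {u v : E → ℝ}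

/-- The variational inequality characterizing the minimizers of the energy among the `K`-Lipschitz
functions that vanish outside `Ω`. -/
structure SolvesVI (g : ℝ → ℝ) (f : ℝ) (Ω : Set E) (K : ℝ≥0) (u : E → ℝ) : Prop where
  mem : VanishingLip Ω K u
  le : ∀ v, VanishingLip Ω K v →
    f * ∫ x, (v - u) x ≤ ∫ x, inner ℝ (flux g (∇ u x)) (∇ (v - u) x)

namespace SolvesVI

theorem sup (hu : SolvesVI g f Ω K u) (hv : LipschitzWith K v) (hv0 : ∀ x ∉ Ω, v x ≤ 0) :
    f * ∫ x, (v - u)⁺ x ≤ ∫ x, inner ℝ (flux g (∇ u x)) (∇ (v - u)⁺ x) := by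
  have h := hu.le (u ⊔ v) ⟨(hu.mem.lip.max hv).weaken (max_self K).le, fun x hx => by
    simp [hu.mem.zero x hx, hv0 x hx]⟩
  rwa [sup_comm, sup_sub, sub_self] at h

theorem inf (hu : SolvesVI g f Ω K u) (hv : LipschitzWith K v) (hv0 : ∀ x ∉ Ω, 0 ≤ v x) :
    ∫ x, inner ℝ (flux g (∇ u x)) (∇ (u - v)⁺ x) ≤ f * ∫ x, (u - v)⁺ x := by
  have h := hu.le (u ⊓ v) ⟨(hu.mem.lip.min hv).weaken (max_self K).le, fun x hx => by
    simp [hu.mem.zero x hx, hv0 x hx]⟩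
  have hneg : u ⊓ v - u = -(u - v)⁺ := by
    rw [inf_sub, sub_self, ← neg_sub u v, ← neg_zero, ← neg_sup, sup_comm, posPart_def]
  simp only [hneg, gradient_neg, inner_neg_right, Pi.neg_apply, integral_neg] at h
  linarith

/-- The gradient constraint is inactive, so `u` may be perturbed in every direction. -/
theorem integral_inner_flux_eq (hLK : L < K) (hL : VanishingLip Ω L u)
    (hu : SolvesVI g f Ω K u) (hv : VanishingLip Ω D v) :
    ∫ x, inner ℝ (flux g (∇ u x)) (∇ v x) = f * ∫ x, v x := by
  have key {v : E → ℝ} (hv : VanishingLip Ω D v) :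
      f * ∫ x, v x ≤ ∫ x, inner ℝ (flux g (∇ u x)) (∇ v x) := by
    obtain ⟨t, ht, htD⟩ : ∃ t : ℝ, 0 < t ∧ L + ‖t‖₊ * D ≤ K := by
      have hpos : (0 : ℝ) < (K - L) / (D + 1) := div_pos (sub_pos.2 (mod_cast hLK)) (by positivity)
      refine ⟨_, hpos, ?_⟩
      rw [← NNReal.coe_le_coe]
      push_cast
      rw [Real.norm_of_nonneg hpos.le, ← le_sub_iff_add_le', div_mul_eq_mul_div,
        div_le_iff₀ (by positivity)]
      have : (L : ℝ) < K := mod_cast hLK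
      gcongr
      linarith
    have h := hu.le (u + t • v) ((hL.add (hv.const_smul t)).mono htD)
    simp only [add_sub_cancel_left, gradient_const_smul, inner_smul_right, Pi.smul_apply,
      smul_eq_mul, integral_const_mul] at h
    refine le_of_mul_le_mul_left ?_ ht
    linarith
  have hneg := key hv.neg
  simp only [gradient_neg, inner_neg_right, Pi.neg_apply, integral_neg] at hneg
  exact le_antisymm (by linarith) (key hv)

end SolvesVI

end VariationalInequality

section Minimization

variable {E : Type*} [NormedAddCommGroup E] [InnerProductSpace ℝ E] [FiniteDimensional ℝ E]
  [MeasureSpace E] [BorelSpace E] [(volume : Measure E).IsAddHaarMeasure]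
  {Ω : Set E} {g : ℝ → ℝ} {c f : ℝ} {K C : ℝ≥0} {u v : E → ℝ}

/-- The energy whose Euler–Lagrange equation is `-div (g(|∇u|²) ∇u) = f`. -/
def energy (g : ℝ → ℝ) (f : ℝ) (u : E → ℝ) : ℝ := ∫ x, (energyDensity g (∇ u x) - f * u x)

namespace VanishingLip

theorem integrable_inner_flux_gradient (hΩ : Bornology.IsBounded Ω) (hg : IsStiffness g c)
    (hu : LipschitzWith C u) (hv : VanishingLip Ω K v) :
    Integrable fun x => inner ℝ (flux g (∇ u x)) (∇ v x) := by
  refine integrable_of_bound_of_eq_zero hΩ.measure_lt_top.ne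
    (aestronglyMeasurable_inner_flux_gradient hg u v volume)
    (norm_inner_flux_gradient_le hg hu hv.lip) ?_
  filter_upwards [hv.ae_gradient_eq_zero] with x hx h
  simp [hx h]

theorem integrable_energyDensity (hΩ : Bornology.IsBounded Ω) (hg : IsStiffness g c)
    (hu : VanishingLip Ω K u) : Integrable fun x => energyDensity g (∇ u x) := by
  refine integrable_of_bound_of_eq_zero hΩ.measure_lt_top.ne (hg.continuous_energyDensity.measurable
    |>.comp (measurable_gradient u)).aestronglyMeasurable (C := g (K ^ 2) * K * K) (fun x => ?_) ?_
  · rw [Real.norm_of_nonneg (hg.energyDensity_nonneg _)]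
    exact hg.energyDensity_le (norm_gradient_le hu.lip x)
  · filter_upwards [hu.ae_gradient_eq_zero] with x hx h
    simp [hx h]

theorem energy_eq (hΩ : Bornology.IsBounded Ω) (hg : IsStiffness g c) (hu : VanishingLip Ω K u) :
    energy g f u = (∫ x, energyDensity g (∇ u x)) - f * ∫ x, u x := by
  rw [energy, integral_sub (hu.integrable_energyDensity hΩ hg) ((hu.integrable hΩ).const_mul f),
    integral_const_mul]

theorem integral_add_smul_sub (hΩ : Bornology.IsBounded Ω) (hu : VanishingLip Ω K u)
    (hv : VanishingLip Ω C v) (t : ℝ) :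
    ∫ x, (u + t • (v - u)) x = (∫ x, u x) + t * ∫ x, (v - u) x := by
  simp only [Pi.add_apply, Pi.smul_apply, smul_eq_mul]
  rw [integral_add (hu.integrable hΩ) (((hv.sub hu).integrable hΩ).const_mul t),
    integral_const_mul]

theorem ae_gradient_add_smul_sub (hu : LipschitzWith K u) (hv : LipschitzWith C v) (t : ℝ) :
    ∀ᵐ x, ∇ (u + t • (v - u)) x = ∇ u x + t • ∇ (v - u) x := by
  filter_upwards [hu.ae_differentiableAt (μ := volume),
    hv.ae_differentiableAt (μ := volume)] with x hx hy
  rw [gradient_add hx ((hy.sub hx).const_smul t), gradient_const_smul]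

theorem energy_midpoint_le (hΩ : Bornology.IsBounded Ω) (hg : IsStiffness g c)
    (hu : VanishingLip Ω K u) (hv : VanishingLip Ω K v) :
    energy g f (u + (1 / 2 : ℝ) • (v - u)) + c / 8 * ∫ x, ‖∇ (v - u) x‖ ^ 2 ≤
      (energy g f u + energy g f v) / 2 := by
  have hm : VanishingLip Ω K (u + (1 / 2 : ℝ) • (v - u)) := hu.add_smul_sub hv (by norm_num)
  have hd : Integrable fun x => c / 8 * ‖∇ (v - u) x‖ ^ 2 :=
    ((hv.sub hu).integrable_norm_gradient_sq hΩ).const_mul _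
  have hU := hu.integrable_energyDensity hΩ hg
  have hV := hv.integrable_energyDensity hΩ hg
  have hM := hm.integrable_energyDensity hΩ hg
  have hdensity : ∫ x, (energyDensity g (∇ (u + (1 / 2 : ℝ) • (v - u)) x) +
      c / 8 * ‖∇ (v - u) x‖ ^ 2) ≤
      ∫ x, (energyDensity g (∇ u x) + energyDensity g (∇ v x)) / 2 := by
    refine integral_mono_ae (hM.add hd) ((hU.add hV).div_const 2) ?_
    filter_upwards [ae_gradient_add_smul_sub hu.lip hv.lip (1 / 2),
      hu.lip.ae_differentiableAt (μ := volume),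
      hv.lip.ae_differentiableAt (μ := volume)] with x hx hdu hdv
    simp only [hx, gradient_sub hdv hdu]
    exact hg.energyDensity_midpoint_le _ _
  rw [integral_add hM hd, integral_const_mul, integral_div, integral_add hU hV] at hdensity
  have hload := hu.integral_add_smul_sub hΩ hv (1 / 2)
  simp only [Pi.sub_apply, integral_sub (hv.integrable hΩ) (hu.integrable hΩ)] at hload
  rw [hm.energy_eq hΩ hg, hu.energy_eq hΩ hg, hv.energy_eq hΩ hg, hload]
  linarith

theorem le_energy [Nontrivial E] (hΩ : Bornology.IsBounded Ω) (hg : IsStiffness g c) {R : ℝ}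
    (hR : 0 ≤ R) (hΩR : Ω ⊆ ball 0 R) (hu : VanishingLip Ω K u) :
    -(|f| * (K * (2 * R) * volume.real Ω)) ≤ energy g f u := by
  have hload : |∫ x, u x| ≤ K * (2 * R) * volume.real Ω := by
    rw [← setIntegral_eq_integral_of_forall_compl_eq_zero (s := Ω) hu.zero, ← Real.norm_eq_abs]
    exact norm_setIntegral_le_of_norm_le_const hΩ.measure_lt_top
      fun x _ => hu.abs_le hR hΩR x
  have habs := (le_abs_self (f * ∫ x, u x)).trans_eq (abs_mul _ _)
  have hdensity : 0 ≤ ∫ x, energyDensity g (∇ u x) :=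
    integral_nonneg fun x => hg.energyDensity_nonneg _
  rw [hu.energy_eq hΩ hg]
  linarith [mul_le_mul_of_nonneg_left hload (abs_nonneg f)]

theorem tendsto_energy [Nontrivial E] (hΩ : Bornology.IsBounded Ω) (hg : IsStiffness g c)
    {w : ℕ → E → ℝ} (hw : ∀ n, VanishingLip Ω K (w n))
    (hlim : ∀ᵐ x, Tendsto (fun n => w n x) atTop (𝓝 (u x)))
    (hlim' : ∀ᵐ x, Tendsto (fun n => ∇ (w n) x) atTop (𝓝 (∇ u x))) :
    Tendsto (fun n => energy g f (w n)) atTop (𝓝 (energy g f u)) := by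
  obtain ⟨R, hR, hΩR⟩ := hΩ.subset_ball_lt 0 0
  refine tendsto_integral_of_bound_of_eq_zero
    (C := g (K ^ 2) * K * K + ‖f‖ * (K * (2 * R))) hΩ.measure_lt_top.ne (fun n => ?_)
    (fun n x => ?_) (fun n => ?_) ?_
  · exact ((hw n).integrable_energyDensity hΩ hg).aestronglyMeasurable.sub
      (((hw n).integrable hΩ).aestronglyMeasurable.const_mul f)
  · refine (norm_sub_le _ _).trans (add_le_add ?_ ?_)
    · rw [Real.norm_of_nonneg (hg.energyDensity_nonneg _)]
      exact hg.energyDensity_le (norm_gradient_le (hw n).lip x)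
    · rw [norm_mul]
      gcongr
      exact (hw n).abs_le hR.le hΩR x
  · filter_upwards [(hw n).ae_gradient_eq_zero] with x hx h
    simp [hx h, (hw n).zero x h]
  · filter_upwards [hlim, hlim'] with x hx hx'
    exact ((hg.continuous_energyDensity.tendsto _).comp hx').sub (hx.const_mul f)

end VanishingLip

theorem exists_minimizing_seq [Nontrivial E] (hΩ : Bornology.IsBounded Ω) (hg : IsStiffness g c)
    (f : ℝ) (K : ℝ≥0) :
    ∃ (m : ℝ) (w : ℕ → E → ℝ), (∀ v, VanishingLip Ω K v → m ≤ energy g f v) ∧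
      ∀ n : ℕ, VanishingLip Ω K (w n) ∧ energy g f (w n) < m + 1 / (n + 1) := by
  obtain ⟨R, hR, hΩR⟩ := hΩ.subset_ball_lt 0 0
  set S : Set ℝ := energy g f '' {v | VanishingLip Ω K v}
  have hne : S.Nonempty :=
    ⟨_, mem_image_of_mem _ ⟨(LipschitzWith.const' (0 : ℝ)).weaken zero_le, fun _ _ => rfl⟩⟩
  have hbdd : BddBelow S := ⟨_, forall_mem_image.2 fun v hv => hv.le_energy hΩ hg hR.le hΩR⟩
  have hseq (n : ℕ) : ∃ v, VanishingLip Ω K v ∧ energy g f v < sInf S + 1 / (n + 1) := by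
    obtain ⟨_, ⟨v, hv, rfl⟩, h⟩ := exists_lt_of_csInf_lt hne
      (lt_add_of_pos_right (sInf S) (Nat.one_div_pos_of_nat (n := n)))
    exact ⟨v, hv, h⟩
  choose w hw using hseq
  exact ⟨sInf S, w, fun v hv => csInf_le hbdd (mem_image_of_mem _ hv), hw⟩

theorem exists_energy_minimizer [Nontrivial E] (hΩ : Bornology.IsBounded Ω)
    (hg : IsStiffness g c) (f : ℝ) (K : ℝ≥0) :
    ∃ u : E → ℝ, VanishingLip Ω K u ∧ ∀ v, VanishingLip Ω K v → energy g f u ≤ energy g f v := by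
  obtain ⟨m, w, hm, hw⟩ := exists_minimizing_seq hΩ hg f K
  have hdist (N n k : ℕ) (hn : N ≤ n) (hk : N ≤ k) :
      ∫ x, ‖∇ (w n - w k) x‖ ^ 2 ≤ 8 / c * (1 / (N + 1)) := by
    have hmid := (hw k).1.energy_midpoint_le (f := f) hΩ hg (hw n).1
    have hmin := hm _ ((hw k).1.add_smul_sub (hw n).1 (t := 1 / 2) (by norm_num))
    have hN : (1 : ℝ) / (n + 1) ≤ 1 / (N + 1) := by gcongr
    have hN' : (1 : ℝ) / (k + 1) ≤ 1 / (N + 1) := by gcongr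
    have hsmall : c / 8 * ∫ x, ‖∇ (w n - w k) x‖ ^ 2 ≤ 1 / (N + 1) := by
      linarith [(hw n).2, (hw k).2]
    rwa [← inv_div, inv_mul_eq_div, le_div_iff₀' (div_pos hg.pos (by norm_num))]
  obtain ⟨u, hu, ns, hns, hlim, hlim'⟩ := VanishingLip.exists_subseq_tendsto_gradient hΩ
    (fun n => (hw n).1)
    (by simpa using tendsto_one_div_add_atTop_nhds_zero_nat.const_mul (8 / c)) hdist
  refine ⟨u, hu, fun v hv => le_trans ?_ (hm v hv)⟩
  have hsum : Tendsto (fun n : ℕ => m + 1 / ((n : ℝ) + 1)) atTop (𝓝 m) := by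
    simpa using tendsto_one_div_add_atTop_nhds_zero_nat.const_add m
  exact le_of_tendsto_of_tendsto' (VanishingLip.tendsto_energy hΩ hg (fun n => (hw _).1) hlim hlim')
    (hsum.comp hns.tendsto_atTop) fun n => (hw _).2.le

theorem VanishingLip.mul_integral_sub_le_of_energy_le (hΩ : Bornology.IsBounded Ω)
    (hg : IsStiffness g c) (hu : VanishingLip Ω K u) (hv : VanishingLip Ω K v) {t : ℝ}
    (ht : 0 < t) (ht' : t ≤ 1) (h : energy g f u ≤ energy g f (u + t • (v - u))) :
    f * ∫ x, (v - u) x ≤ ∫ x, inner ℝ (flux g (∇ (u + t • (v - u)) x)) (∇ (v - u) x) := by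
  have hz : VanishingLip Ω K (u + t • (v - u)) := hu.add_smul_sub hv ⟨ht.le, ht'⟩
  have hU := hu.integrable_energyDensity hΩ hg
  have hF := ((hv.sub hu).integrable_inner_flux_gradient hΩ hg hz.lip).const_mul t
  have hconvex : ∫ x, energyDensity g (∇ (u + t • (v - u)) x) ≤ ∫ x, (energyDensity g (∇ u x) +
      t * inner ℝ (flux g (∇ (u + t • (v - u)) x)) (∇ (v - u) x)) := by
    refine integral_mono_ae (hz.integrable_energyDensity hΩ hg) (hU.add hF) ?_
    filter_upwards [ae_gradient_add_smul_sub hu.lip hv.lip t] with x hx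
    have hle := hg.energyDensity_add_inner_flux_le (∇ (u + t • (v - u)) x) (∇ u x)
    rw [hx, sub_add_cancel_left, inner_neg_right, inner_smul_right, norm_neg] at hle
    rw [hx]
    linarith [mul_nonneg (half_pos hg.pos).le (sq_nonneg ‖t • ∇ (v - u) x‖)]
  rw [integral_add hU hF, integral_const_mul] at hconvex
  rw [hu.energy_eq hΩ hg, hz.energy_eq hΩ hg, hu.integral_add_smul_sub hΩ hv] at h
  refine le_of_mul_le_mul_left ?_ ht
  linarith

theorem SolvesVI.of_forall_energy_le (hΩ : Bornology.IsBounded Ω) (hg : IsStiffness g c)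
    (hu : VanishingLip Ω K u) (h : ∀ v, VanishingLip Ω K v → energy g f u ≤ energy g f v) :
    SolvesVI g f Ω K u := by
  refine ⟨hu, fun v hv => ?_⟩
  let t (n : ℕ) : ℝ := 1 / (n + 1)
  have ht (n : ℕ) : 0 < t n := Nat.one_div_pos_of_nat
  have ht' (n : ℕ) : t n ≤ 1 := by simpa [t] using Nat.cast_inv_le_one (α := ℝ) (n + 1)
  have hz (n : ℕ) : VanishingLip Ω K (u + t n • (v - u)) := hu.add_smul_sub hv ⟨(ht n).le, ht' n⟩
  refine ge_of_tendsto' (tendsto_integral_of_bound_of_eq_zero hΩ.measure_lt_top.ne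
    (fun n => aestronglyMeasurable_inner_flux_gradient hg _ _ volume)
    (fun n => norm_inner_flux_gradient_le hg (hz n).lip (hv.sub hu).lip) (fun n => ?_) ?_)
    fun n => hu.mul_integral_sub_le_of_energy_le hΩ hg hv (ht n) (ht' n) (h _ (hz n))
  · filter_upwards [(hv.sub hu).ae_gradient_eq_zero] with x hx h
    simp [hx h]
  · filter_upwards [ae_all_iff.2 fun n =>
      VanishingLip.ae_gradient_add_smul_sub hu.lip hv.lip (t n)] with x hx
    refine ((hg.continuous_flux.tendsto _).comp ?_).inner tendsto_const_nhds
    simp only [hx]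
    have ht0 : Tendsto t atTop (𝓝 0) := tendsto_one_div_add_atTop_nhds_zero_nat
    simpa using (ht0.smul_const (∇ (v - u) x)).const_add (∇ u x)

end Minimization

section Barrier

variable {E : Type*} [NormedAddCommGroup E] [InnerProductSpace ℝ E] {e x : E} {Ω : Set E}
  {g : ℝ → ℝ} {c m β ℓ R : ℝ}

/-- The barrier `β (ℓ² - t²)⁺ / 2` in the coordinate `t = ⟪e, x⟫ - m`. With `t = ℓ` a supporting
hyperplane of `Ω`, it dominates the solution with slope `β ℓ` at the boundary. -/
def barrier (β ℓ m : ℝ) (e : E) : E → ℝ := β • (fun x => (ℓ ^ 2 - (inner ℝ e x - m) ^ 2) / 2)⁺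

theorem barrier_apply (β ℓ m : ℝ) (e x : E) :
    barrier β ℓ m e x = β * ((ℓ ^ 2 - (inner ℝ e x - m) ^ 2) / 2)⁺ := rfl

theorem barrier_nonneg (hβ : 0 ≤ β) (x : E) : 0 ≤ barrier β ℓ m e x :=
  mul_nonneg hβ (posPart_nonneg _)

theorem barrier_eq_zero (hℓ : 0 ≤ ℓ) (hx : ℓ ≤ inner ℝ e x - m) : barrier β ℓ m e x = 0 := by
  rw [barrier_apply, posPart_of_nonpos, mul_zero]
  linarith [pow_le_pow_left₀ hℓ hx 2]

theorem posPart_sq_sub_sq_le (hℓ : 0 ≤ ℓ) (s t : ℝ) :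
    ((ℓ ^ 2 - s ^ 2) / 2)⁺ ≤ ((ℓ ^ 2 - t ^ 2) / 2)⁺ + ℓ * |s - t| := by
  rcases le_total ℓ |s| with hs | hs
  · rw [posPart_of_nonpos (by linarith [sq_abs s, pow_le_pow_left₀ hℓ hs 2])]
    positivity
  · rw [posPart_of_nonneg (by linarith [sq_abs s, pow_le_pow_left₀ (abs_nonneg s) hs 2])]
    have hst := abs_sub_abs_le_abs_sub t s
    rw [abs_sub_comm] at hst
    rcases le_total ℓ |t| with ht | ht
    · nlinarith [sq_abs s, posPart_nonneg ((ℓ ^ 2 - t ^ 2) / 2)]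
    · nlinarith [sq_abs s, sq_abs t, le_posPart ((ℓ ^ 2 - t ^ 2) / 2), abs_nonneg (s - t),
        abs_nonneg s, abs_nonneg t]

theorem lipschitzWith_barrier (hβ : 0 ≤ β) (hℓ : 0 ≤ ℓ) (he : ‖e‖ = 1) (m : ℝ) {K : ℝ≥0}
    (hK : β * ℓ ≤ K) : LipschitzWith K (barrier β ℓ m e) := by
  refine LipschitzWith.of_le_add_mul _ fun x y => ?_
  have hinner : |inner ℝ e x - m - (inner ℝ e y - m)| ≤ dist x y := by
    rw [sub_sub_sub_cancel_right, ← inner_sub_right, dist_eq_norm, ← one_mul ‖x - y‖, ← he]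
    exact abs_real_inner_le_norm _ _
  calc barrier β ℓ m e x
      ≤ β * (((ℓ ^ 2 - (inner ℝ e y - m) ^ 2) / 2)⁺ + ℓ * dist x y) := by
        rw [barrier_apply]
        gcongr
        exact (posPart_sq_sub_sq_le hℓ _ _).trans (by gcongr)
    _ = barrier β ℓ m e y + β * ℓ * dist x y := by rw [barrier_apply]; ring
    _ ≤ barrier β ℓ m e y + K * dist x y := by gcongr

theorem gradient_barrier [CompleteSpace E] (β : ℝ) (hx : inner ℝ e x - m ∈ Ioo 0 ℓ) :
    ∇ (barrier β ℓ m e) x = -(β * (inner ℝ e x - m)) • e := by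
  have hpos : 0 < (ℓ ^ 2 - (inner ℝ e x - m) ^ 2) / 2 := by
    linarith [pow_lt_pow_left₀ hx.2 hx.1.le two_ne_zero]
  have hquad : ∇ (fun x => (ℓ ^ 2 - (inner ℝ e x - m) ^ 2) / 2) x = -(inner ℝ e x - m) • e := by
    refine HasGradientAt.gradient (hasGradientAt_iff_hasFDerivAt.2 ?_)
    have hderiv := (((innerSL ℝ e).hasFDerivAt (x := x)).sub_const m).pow 2
    convert! (hderiv.const_sub (ℓ ^ 2)).mul_const (2⁻¹ : ℝ) using 1
    ext y
    simp
    ring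
  rw [barrier, gradient_const_smul, gradient_posPart (by fun_prop), indicator_of_mem, hquad,
    smul_smul, neg_mul_eq_mul_neg]
  exact hpos

theorem exists_supporting_slab [CompleteSpace E] (hΩo : IsOpen Ω) (hΩc : Convex ℝ Ω)
    (hne : Ω.Nonempty) (hΩR : Ω ⊆ ball 0 R) {y : E} (hy : y ∉ Ω) :
    ∃ (e : E) (m : ℝ), ‖e‖ = 1 ∧ 2 * R ≤ inner ℝ e y - m ∧
      ∀ x ∈ Ω, inner ℝ e x - m ∈ Ioo 0 (2 * R) := by
  obtain ⟨φ, hφ⟩ := geometric_hahn_banach_open_point hΩc hΩo hy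
  obtain ⟨p, rfl⟩ := (InnerProductSpace.toDual ℝ E).surjective φ
  simp only [InnerProductSpace.toDual_apply_apply] at hφ
  have hp : p ≠ 0 := by
    rintro rfl
    obtain ⟨x, hx⟩ := hne
    simpa using hφ x hx
  have he : ‖‖p‖⁻¹ • p‖ = 1 := norm_smul_inv_norm hp
  refine ⟨‖p‖⁻¹ • p, min (inner ℝ (‖p‖⁻¹ • p) y) R - 2 * R, he, ?_, fun x hx => ?_⟩
  · linarith [min_le_left (inner ℝ (‖p‖⁻¹ • p) y) R]
  · have hlt : inner ℝ (‖p‖⁻¹ • p) x < inner ℝ (‖p‖⁻¹ • p) y := by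
      rw [real_inner_smul_left, real_inner_smul_left]
      gcongr
      exact hφ x hx
    have hxR : |inner ℝ (‖p‖⁻¹ • p) x| < R := (abs_real_inner_le_norm _ x).trans_lt <| by
      rw [he, one_mul]
      exact mem_ball_zero_iff.1 (hΩR hx)
    have hmin := lt_min hlt (abs_lt.1 hxR).2
    exact ⟨by linarith [(abs_lt.1 hxR).1, min_le_right (inner ℝ (‖p‖⁻¹ • p) y) R], by linarith⟩

end Barrier

section Comparison

variable {E : Type*} [NormedAddCommGroup E] [InnerProductSpace ℝ E] [FiniteDimensional ℝ E]
  [MeasureSpace E] [BorelSpace E] [(volume : Measure E).IsAddHaarMeasure]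
  {Ω : Set E} {g : ℝ → ℝ} {c f : ℝ} {K C D L : ℝ≥0} {u v w z P Q : E → ℝ} {e : E}

theorem integral_mul_inner_gradient_nonneg {ψ : E → ℝ} (hψ : Continuous ψ)
    (hψe : ∀ x, ∀ t : ℝ, 0 ≤ t → ψ (x + t • e) ≤ ψ x) (hz : LipschitzWith K z)
    (hzc : HasCompactSupport z) (hz0 : ∀ x, 0 ≤ z x) :
    0 ≤ ∫ x, ψ x * inner ℝ (∇ z x) e := by
  have hlim := hz.integral_inv_smul_sub_mul_tendsto_integral_lineDeriv_mul' (μ := volume)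
    hzc hψ e
  have hcongr : ∫ x, lineDeriv ℝ z x e * ψ x = ∫ x, ψ x * inner ℝ (∇ z x) e := by
    refine integral_congr_ae ?_
    filter_upwards [ae_lineDeriv_eq_inner_gradient hz e] with x hx
    rw [hx, mul_comm]
  rw [hcongr] at hlim
  refine ge_of_tendsto hlim ?_
  filter_upwards [self_mem_nhdsWithin] with t (ht : 0 < t)
  have hshift : ∫ x, z (x + t • e) * ψ x = ∫ x, z x * ψ (x - t • e) := by
    simpa using integral_add_right_eq_self (μ := volume) (fun x => z x * ψ (x - t • e)) (t • e)
  have hi : Integrable fun x => z (x + t • e) * ψ x :=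
    ((hz.continuous.comp (continuous_add_const _)).mul hψ).integrable_of_hasCompactSupport
      (hzc.comp_homeomorph (Homeomorph.addRight (t • e))).mul_right
  have hi' {φ : E → ℝ} (hφ : Continuous φ) : Integrable fun x => z x * φ x :=
    (hz.continuous.mul hφ).integrable_of_hasCompactSupport hzc.mul_right
  have hquot : ∫ x, (t⁻¹ • (z (x + t • e) - z x)) * ψ x =
      t⁻¹ * ∫ x, z x * (ψ (x - t • e) - ψ x) := by
    simp only [smul_eq_mul, mul_assoc, integral_const_mul]
    simp only [sub_mul, mul_sub]
    rw [integral_sub hi (hi' hψ), hshift,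
      integral_sub (hi' (φ := fun x => ψ (x - t • e)) (hψ.comp (continuous_sub_right _))) (hi' hψ)]
  rw [hquot]
  refine mul_nonneg (inv_pos.2 ht).le (integral_nonneg fun x => mul_nonneg (hz0 x) ?_)
  have h := hψe (x - t • e) t ht.le
  rw [sub_add_cancel] at h
  exact sub_nonneg.2 h

theorem VanishingLip.integrable_mul_inner_gradient (hΩ : Bornology.IsBounded Ω)
    (hz : VanishingLip Ω K z) {φ : E → ℝ} (hφ : Continuous φ) (e : E) :
    Integrable fun x => φ x * inner ℝ (∇ z x) e := by
  have hcl : IsCompact (closure Ω) := hΩ.isCompact_closure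
  have hbound (x : E) : ‖inner ℝ (∇ z x) e‖ ≤ K * ‖e‖ :=
    (norm_inner_le_norm _ _).trans (by gcongr; exact norm_gradient_le hz.lip x)
  have hI : IntegrableOn (fun x => inner ℝ (∇ z x) e) (closure Ω) :=
    .of_bound hcl.measure_lt_top
      ((measurable_gradient z).inner measurable_const).aestronglyMeasurable _ (.of_forall hbound)
  refine (hI.continuousOn_mul hφ.continuousOn hcl).integrable_of_ae_notMem_eq_zero ?_
  filter_upwards [hz.ae_gradient_eq_zero] with x hx h
  simp [hx fun h' => h (subset_closure h')]

/-- With `t = ⟪e, x⟫ - m` the flux of the barrier is `-(g(β²t²) - c) β t e - c β t e`, where the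
first coefficient is nonincreasing in `t ≥ 0` and the second integrates by parts to `c β ∫ z`. -/
theorem mul_integral_le_integral_flux_barrier (hg : IsStiffness g c) {β ℓ m : ℝ} (hβ : 0 ≤ β)
    (hΩ : Bornology.IsBounded Ω) (he : ‖e‖ = 1) (hslab : ∀ x ∈ Ω, inner ℝ e x - m ∈ Ioo 0 ℓ)
    (hz : VanishingLip Ω K z) (hz0 : ∀ x, 0 ≤ z x) :
    c * β * ∫ x, z x ≤ ∫ x, inner ℝ (flux g (∇ (barrier β ℓ m e) x)) (∇ z x) := by
  let t (x : E) : ℝ := inner ℝ e x - m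
  let ψ (x : E) : ℝ := -((g ((β * (t x)⁺) ^ 2) - c) * (β * (t x)⁺))
  have ht : Continuous t := by fun_prop
  have htp : Continuous fun x => (t x)⁺ := ht.max continuous_const
  have hψ : Continuous ψ :=
    (((hg.cont.comp ((htp.const_mul β).pow 2)).sub continuous_const).mul (htp.const_mul β)).neg
  have hψe (x : E) (s : ℝ) (hs : 0 ≤ s) : ψ (x + s • e) ≤ ψ x := by
    have hts : t x ≤ t (x + s • e) := by
      simp only [t, inner_add_right, inner_smul_right, real_inner_self_eq_norm_sq, he]
      linarith
    have hts' : (t x)⁺ ≤ (t (x + s • e))⁺ := posPart_mono hts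
    refine neg_le_neg (mul_le_mul ?_ (by gcongr) (by positivity) (sub_nonneg.2 (hg.le _)))
    exact sub_le_sub_right (hg.mono (by gcongr)) c
  have hsplit : ∫ x, inner ℝ (flux g (∇ (barrier β ℓ m e) x)) (∇ z x) =
      ∫ x, (ψ x * inner ℝ (∇ z x) e - c * β * (t x * inner ℝ (∇ z x) e)) := by
    refine integral_congr_ae ?_
    filter_upwards [hz.ae_gradient_eq_zero] with x hx
    by_cases h : x ∈ Ω
    · rw [gradient_barrier β (hslab x h), flux, norm_smul, he, mul_one, norm_neg, Real.norm_eq_abs,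
        sq_abs, real_inner_smul_left, real_inner_smul_left, real_inner_comm (∇ z x) e]
      simp only [ψ, t, posPart_of_nonneg (hslab x h).1.le]
      ring
    · simp [hx h]
  rw [hsplit, integral_sub (hz.integrable_mul_inner_gradient hΩ hψ e)
    ((hz.integrable_mul_inner_gradient hΩ ht e).const_mul _), integral_const_mul]
  have hparts : ∫ x, t x * inner ℝ (∇ z x) e = -∫ x, z x :=
    integral_inner_mul_inner_gradient he m hz.lip (hz.hasCompactSupport hΩ)
  have hnonneg := integral_mul_inner_gradient_nonneg hψ hψe hz.lip (hz.hasCompactSupport hΩ) hz0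
  rw [hparts]
  linarith

theorem le_of_integral_flux_le [Nontrivial E] (hΩ : Bornology.IsBounded Ω) (hg : IsStiffness g c)
    (hP : LipschitzWith C P) (hQ : LipschitzWith D Q) (hPQ : ∀ x ∉ Ω, P x ≤ Q x)
    (h : ∫ x, inner ℝ (flux g (∇ P x)) (∇ (P - Q)⁺ x) ≤
      ∫ x, inner ℝ (flux g (∇ Q x)) (∇ (P - Q)⁺ x)) : P ≤ Q := by
  have hz : VanishingLip Ω (C + D) (P - Q)⁺ := .posPart_sub hP hQ hPQ
  have hIP := hz.integrable_inner_flux_gradient hΩ hg hP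
  have hIQ := hz.integrable_inner_flux_gradient hΩ hg hQ
  have hI := hz.integrable_norm_gradient_sq hΩ
  have hmono : ∫ x, c * ‖∇ (P - Q)⁺ x‖ ^ 2 ≤ ∫ x, (inner ℝ (flux g (∇ P x)) (∇ (P - Q)⁺ x) -
      inner ℝ (flux g (∇ Q x)) (∇ (P - Q)⁺ x)) := by
    refine integral_mono_ae (hI.const_mul c) (hIP.sub hIQ) ?_
    filter_upwards [hP.ae_differentiableAt (μ := volume),
      hQ.ae_differentiableAt (μ := volume)] with x hx hx'
    rw [← inner_sub_left, gradient_posPart (f := P - Q) (hP.sub hQ).continuous]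
    by_cases hpos : x ∈ {x | 0 < (P - Q) x}
    · rw [indicator_of_mem hpos]
      rw [gradient_sub hx hx']
      exact hg.mul_norm_sub_sq_le_inner_flux_sub _ _
    · rw [indicator_of_notMem hpos]
      simp
  rw [integral_const_mul, integral_sub hIP hIQ] at hmono
  have hzero : ∫ x, ‖∇ (P - Q)⁺ x‖ ^ 2 = 0 := by
    refine le_antisymm (le_of_mul_le_mul_left ?_ hg.pos) (integral_nonneg fun x => by positivity)
    linarith
  rw [integral_eq_zero_iff_of_nonneg (fun x => by positivity) hI] at hzero
  have hz0 := hz.eq_zero_of_gradient_ae_eq_zero hΩ (hzero.mono fun x hx => by simpa using hx)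
  exact fun x => sub_nonpos.1 (posPart_eq_zero.1 (congrFun hz0 x))

namespace SolvesVI

theorem nonneg [Nontrivial E] (hΩ : Bornology.IsBounded Ω) (hg : IsStiffness g c) (hf : 0 ≤ f)
    (hu : SolvesVI g f Ω K u) : 0 ≤ u := by
  have h0 : LipschitzWith K (0 : E → ℝ) := (LipschitzWith.const' (0 : ℝ)).weaken zero_le
  refine le_of_integral_flux_le hΩ hg h0 hu.mem.lip (fun x hx => (hu.mem.zero x hx).ge) ?_
  refine le_trans (le_of_eq ?_) ((mul_nonneg hf ?_).trans (hu.sup h0 fun _ _ => le_rfl))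
  · have hflux (x : E) : flux g (∇ (0 : E → ℝ) x) = 0 := by simp [flux, gradient]
    simp only [hflux, inner_zero_left, integral_zero]
  · exact integral_nonneg fun x => posPart_nonneg _

theorem le_barrier [Nontrivial E] (hΩ : Bornology.IsBounded Ω) (hg : IsStiffness g c)
    (hu : SolvesVI g f Ω K u) (hf : 0 ≤ f) (he : ‖e‖ = 1) {m ℓ : ℝ} (hℓ : 0 ≤ ℓ)
    (hK : f / c * ℓ ≤ K) (hslab : ∀ x ∈ Ω, inner ℝ e x - m ∈ Ioo 0 ℓ) :
    u ≤ barrier (f / c) ℓ m e := by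
  have hβ : 0 ≤ f / c := div_nonneg hf hg.pos.le
  have hB : LipschitzWith K (barrier (f / c) ℓ m e) := lipschitzWith_barrier hβ hℓ he m hK
  have hout (x) (hx : x ∉ Ω) : u x ≤ barrier (f / c) ℓ m e x := by
    rw [hu.mem.zero x hx]
    exact barrier_nonneg hβ x
  have hsuper := mul_integral_le_integral_flux_barrier hg hβ hΩ he hslab
    (.posPart_sub hu.mem.lip hB hout) fun x => posPart_nonneg _
  rw [mul_div_cancel₀ f hg.pos.ne'] at hsuper
  exact le_of_integral_flux_le hΩ hg hu.mem.lip hB hout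
    ((hu.inf hB fun x _ => barrier_nonneg hβ x).trans hsuper)

theorem le_mul_norm_sub [Nontrivial E] (hΩo : IsOpen Ω) (hΩc : Convex ℝ Ω) {R : ℝ} (hR : 0 ≤ R)
    (hΩR : Ω ⊆ ball 0 R) (hg : IsStiffness g c) (hf : 0 ≤ f) (hu : SolvesVI g f Ω K u)
    (hL : f / c * (2 * R) ≤ L) (hLK : L ≤ K) (x : E) {y : E} (hy : y ∉ Ω) :
    u x ≤ L * ‖x - y‖ := by
  by_cases hx : x ∈ Ω
  · obtain ⟨e, m, he, hym, hslab⟩ := exists_supporting_slab hΩo hΩc ⟨x, hx⟩ hΩR hy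
    have hℓ : 0 ≤ 2 * R := by positivity
    calc u x ≤ barrier (f / c) (2 * R) m e x :=
          hu.le_barrier (isBounded_ball.subset hΩR) hg hf he hℓ (hL.trans (mod_cast hLK)) hslab x
      _ ≤ barrier (f / c) (2 * R) m e y + L * dist x y :=
          (lipschitzWith_barrier (div_nonneg hf hg.pos.le) hℓ he m hL).le_add_mul x y
      _ = L * ‖x - y‖ := by rw [barrier_eq_zero hℓ hym, zero_add, dist_eq_norm]
  · rw [hu.mem.zero x hx]
    positivity

/-- Both `u` and its translate solve the variational inequality, so boundary values control the
difference. -/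
theorem comp_add_right_le [Nontrivial E] (hΩ : Bornology.IsBounded Ω) (hg : IsStiffness g c)
    (hu : SolvesVI g f Ω K u) (hu0 : 0 ≤ u) {h : E} {M : ℝ} (hM : 0 ≤ M)
    (hout : ∀ x ∉ Ω, u (x + h) ≤ M) (x : E) : u (x + h) ≤ u x + M := by
  have hP : LipschitzWith K fun x => u (x + h) := lipschitzWith_comp_add_right hu.mem.lip h
  have hQ : LipschitzWith K fun x => u x + M := lipschitzWith_add_const hu.mem.lip M
  set z : E → ℝ := ((fun x => u (x + h)) - fun x => u x + M)⁺
  have hsup : f * ∫ x, z x ≤ ∫ x, inner ℝ (flux g (∇ u x)) (∇ z x) := by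
    have hz : z = ((fun x => u (x + h) + -M) - u)⁺ := by
      ext y
      simp only [z, Pi.posPart_apply, Pi.sub_apply]
      ring_nf
    rw [hz]
    exact hu.sup (lipschitzWith_add_const hP _) fun y hy => by linarith [hout y hy]
  have hinf : ∫ x, inner ℝ (flux g (∇ u (x + h))) (∇ z x) ≤ f * ∫ x, z x := by
    let w : E → ℝ := (u - fun x => u (x + -h) + M)⁺
    have hz : z = fun x => w (x + h) := by
      ext y
      simp only [z, w, Pi.posPart_apply, Pi.sub_apply, add_neg_cancel_right, sub_add_eq_sub_sub]
    simp only [hz, gradient_comp_add_right]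
    rw [integral_add_right_eq_self w,
      integral_add_right_eq_self fun x => inner ℝ (flux g (∇ u x)) (∇ w x)]
    exact hu.inf (lipschitzWith_add_const (lipschitzWith_comp_add_right hu.mem.lip _) M)
      fun y _ => add_nonneg (hu0 _) hM
  refine le_of_integral_flux_le hΩ hg hP hQ (fun y hy => ?_) ?_ x
  · rw [hu.mem.zero y hy, zero_add]
    exact hout y hy
  · simp only [gradient_add_const, gradient_comp_add_right]
    exact hinf.trans hsup

theorem vanishingLip [Nontrivial E] (hΩo : IsOpen Ω) (hΩc : Convex ℝ Ω) {R : ℝ} (hR : 0 ≤ R)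
    (hΩR : Ω ⊆ ball 0 R) (hg : IsStiffness g c) (hf : 0 ≤ f) (hu : SolvesVI g f Ω K u)
    (hL : f / c * (2 * R) ≤ L) (hLK : L ≤ K) : VanishingLip Ω L u := by
  have hΩ : Bornology.IsBounded Ω := isBounded_ball.subset hΩR
  refine ⟨LipschitzWith.of_le_add_mul _ fun x y => ?_, hu.mem.zero⟩
  have h := hu.comp_add_right_le hΩ hg (hu.nonneg hΩ hg hf) (h := x - y) (M := L * ‖x - y‖)
    (by positivity) (fun z hz => ?_) y
  · rwa [add_sub_cancel, ← dist_eq_norm] at h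
  · simpa using hu.le_mul_norm_sub hΩo hΩc hR hΩR hg hf hL hLK (z + (x - y)) hz

end SolvesVI

theorem exists_lipschitz_solution [Nontrivial E] (hΩo : IsOpen Ω) (hΩc : Convex ℝ Ω)
    (hΩ : Bornology.IsBounded Ω) (hg : IsStiffness g c) (hf : 0 ≤ f) :
    ∃ (L : ℝ≥0) (u : E → ℝ), VanishingLip Ω L u ∧ 0 ≤ u ∧ ∀ (D : ℝ≥0) (v : E → ℝ),
      VanishingLip Ω D v → ∫ x, inner ℝ (flux g (∇ u x)) (∇ v x) = f * ∫ x, v x := by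
  obtain ⟨R, hR, hΩR⟩ := hΩ.subset_ball_lt 0 0
  set L : ℝ≥0 := (f / c * (2 * R)).toNNReal
  obtain ⟨u, hu, hmin⟩ := exists_energy_minimizer hΩ hg f (L + 1)
  have hVI := SolvesVI.of_forall_energy_le hΩ hg hu hmin
  have hL : VanishingLip Ω L u :=
    hVI.vanishingLip hΩo hΩc hR.le hΩR hg hf (Real.le_coe_toNNReal _) le_self_add
  exact ⟨L, u, hL, hVI.nonneg hΩ hg hf,
    fun D v hv => hVI.integral_inner_flux_eq (lt_add_one L) hL hv⟩

end Comparison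

section Mollification

variable {E : Type*} [NormedAddCommGroup E] [InnerProductSpace ℝ E] [FiniteDimensional ℝ E]
  [MeasureSpace E] [BorelSpace E] [(volume : Measure E).IsAddHaarMeasure]
  {Ω : Set E} {K : ℝ≥0} {w ρ : E → ℝ}

theorem hasFDerivAt_integral_mul_comp_sub (hρ : Continuous ρ) (hρc : HasCompactSupport ρ)
    (hw : LipschitzWith K w) (x : E) :
    Integrable (fun t => ρ t • fderiv ℝ w (x - t)) ∧
      HasFDerivAt (fun y => ∫ t, ρ t * w (y - t)) (∫ t, ρ t • fderiv ℝ w (x - t)) x := by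
  have hcont (y : E) : Continuous fun t => ρ t * w (y - t) :=
    hρ.mul (hw.continuous.comp (continuous_const.sub continuous_id))
  have hae : ∀ᵐ t : E, DifferentiableAt ℝ w (x - t) :=
    (quasiMeasurePreserving_sub_left volume x).ae (hw.ae_differentiableAt (μ := volume))
  refine hasFDerivAt_integral_of_dominated_loc_of_lip (𝕜 := ℝ) (s := univ)
    (bound := fun t => |ρ t| * K) univ_mem (.of_forall fun y => (hcont y).aestronglyMeasurable)
    ((hcont x).integrable_of_hasCompactSupport hρc.mul_right)
    (hρ.aestronglyMeasurable.smul
      ((measurable_fderiv ℝ w).comp (measurable_const.sub measurable_id)).aestronglyMeasurable)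
    (.of_forall fun t => LipschitzWith.lipschitzOnWith ?_)
    ((hρ.integrable_of_hasCompactSupport hρc).abs.mul_const _) ?_
  · refine LipschitzWith.of_dist_le_mul fun y z => ?_
    have h := hw.dist_le_mul (y - t) (z - t)
    rw [dist_sub_right, Real.dist_eq] at h
    rw [Real.dist_eq, ← mul_sub, abs_mul, Real.coe_nnabs, abs_mul, abs_abs, NNReal.abs_eq,
      mul_assoc]
    gcongr
  · filter_upwards [hae] with t ht
    exact (ht.hasFDerivAt.comp x ((hasFDerivAt_id x).sub_const t)).const_mul _

theorem gradient_convolution (hρ : Continuous ρ) (hρc : HasCompactSupport ρ)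
    (hw : LipschitzWith K w) :
    ∇ (ρ ⋆[ContinuousLinearMap.lsmul ℝ ℝ, volume] w) =
      ρ ⋆[ContinuousLinearMap.lsmul ℝ ℝ, volume] ∇ w := by
  ext1 x
  obtain ⟨hint, hderiv⟩ := hasFDerivAt_integral_mul_comp_sub hρ hρc hw x
  have hint' : Integrable fun t => ρ t • ∇ w (x - t) := by
    let T : StrongDual ℝ E →L[ℝ] E :=
      (InnerProductSpace.toDual ℝ E).symm.toContinuousLinearEquiv.toContinuousLinearMap
    simpa [T, gradient] using T.integrable_comp hint
  refine HasGradientAt.gradient (hasGradientAt_iff_hasFDerivAt.2 ?_)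
  convert! hderiv using 1
  ext y
  rw [InnerProductSpace.toDual_apply_apply, ContinuousLinearMap.integral_apply hint,
    convolution_def, real_inner_comm]
  simp only [ContinuousLinearMap.lsmul_apply]
  rw [← integral_inner hint']
  simp [real_inner_comm _ y, real_inner_smul_left, inner_gradient_left]

theorem norm_normed_convolution_le {F : Type*} [NormedAddCommGroup F] [NormedSpace ℝ F]
    [CompleteSpace F] (η : ContDiffBump (0 : E)) {q : E → F} (hq : AEStronglyMeasurable q) {C : ℝ}
    (hC : ∀ x, ‖q x‖ ≤ C) (x : E) :
    ‖(η.normed volume ⋆[ContinuousLinearMap.lsmul ℝ ℝ, volume] q) x‖ ≤ C := by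
  rw [← dist_zero_right]
  exact dist_convolution_le ((norm_nonneg _).trans (hC x)) η.support_normed_eq.subset
    η.nonneg_normed η.integral_normed hq fun y _ => (dist_zero_right _).trans_le (hC y)

theorem tsupport_normed_convolution_subset (η : ContDiffBump (0 : E)) (w : E → ℝ) :
    tsupport (η.normed volume ⋆[ContinuousLinearMap.lsmul ℝ ℝ, volume] w) ⊆
      cthickening η.rOut (tsupport w) := by
  refine closure_minimal ((support_convolution_subset_swap _).trans ?_) isClosed_cthickening
  rintro _ ⟨y, hy, t, ht, rfl⟩
  rw [η.support_normed_eq, mem_ball_zero_iff] at ht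
  refine mem_cthickening_of_dist_le _ y _ _ (subset_tsupport _ hy) ?_
  simpa using ht.le

theorem lipschitzWith_normed_convolution (η : ContDiffBump (0 : E)) (hw : LipschitzWith K w) :
    LipschitzWith K (η.normed volume ⋆[ContinuousLinearMap.lsmul ℝ ℝ, volume] w) := by
  have hsmooth := η.hasCompactSupport_normed.contDiff_convolution_left
    (μ := volume) (ContinuousLinearMap.lsmul ℝ ℝ) (η.contDiff_normed (n := 1) (μ := volume))
    hw.continuous.locallyIntegrable
  refine lipschitzWith_of_nnnorm_fderiv_le (hsmooth.differentiable one_ne_zero) fun x => ?_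
  have h := norm_normed_convolution_le η (measurable_gradient w).aestronglyMeasurable
    (norm_gradient_le hw) x
  rw [← gradient_convolution η.continuous_normed η.hasCompactSupport_normed hw, gradient,
    LinearIsometryEquiv.norm_map] at h
  exact h

theorem VanishingLip.exists_contDiff_tendsto (hΩo : IsOpen Ω) (hΩ : Bornology.IsBounded Ω)
    (hw : VanishingLip Ω K w) (hs : tsupport w ⊆ Ω) :
    ∃ ψ : ℕ → E → ℝ, (∀ n, ContDiff ℝ ∞ (ψ n)) ∧ (∀ n, tsupport (ψ n) ⊆ Ω) ∧
      (∀ n, LipschitzWith K (ψ n)) ∧ (∀ x, Tendsto (fun n => ψ n x) atTop (𝓝 (w x))) ∧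
      ∀ᵐ x, Tendsto (fun n => ∇ (ψ n) x) atTop (𝓝 (∇ w x)) := by
  obtain ⟨δ, hδ, hδs⟩ := (hw.hasCompactSupport hΩ).isCompact.exists_cthickening_subset_open hΩo hs
  obtain ⟨ε, -, hε, hε0⟩ := exists_seq_strictAnti_tendsto' hδ
  let η (n : ℕ) : ContDiffBump (0 : E) := ⟨ε n / 2, ε n, half_pos (hε n).1, half_lt_self (hε n).1⟩
  have hloc : LocallyIntegrable (∇ w) :=
    (memLp_top_of_bound (measurable_gradient w).aestronglyMeasurable K
      (.of_forall (norm_gradient_le hw.lip))).locallyIntegrable le_top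
  refine ⟨fun n => (η n).normed volume ⋆[ContinuousLinearMap.lsmul ℝ ℝ, volume] w,
    fun n => (η n).hasCompactSupport_normed.contDiff_convolution_left _ (η n).contDiff_normed
      hw.lip.continuous.locallyIntegrable,
    fun n => (tsupport_normed_convolution_subset (η n) w).trans
      ((cthickening_mono (hε n).2.le _).trans hδs),
    fun n => lipschitzWith_normed_convolution (η n) hw.lip,
    ContDiffBump.convolution_tendsto_right_of_continuous hε0 hw.lip.continuous, ?_⟩
  simp only [gradient_convolution (η _).continuous_normed (η _).hasCompactSupport_normed hw.lip]
  exact ContDiffBump.ae_convolution_tendsto_right_of_locallyIntegrable (K := 2) hε0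
    (.of_forall fun n => by simp [η, mul_div_cancel₀]) hloc

/-- The truncations `(w - δ)⁺` have their support in `{δ ≤ w} ⊆ Ω`. -/
theorem VanishingLip.exists_tsupport_subset_tendsto (hw : VanishingLip Ω K w) (hw0 : 0 ≤ w) :
    ∃ v : ℕ → E → ℝ, (∀ n, VanishingLip Ω K (v n)) ∧ (∀ n, tsupport (v n) ⊆ Ω) ∧
      (∀ x, Tendsto (fun n => v n x) atTop (𝓝 (w x))) ∧
      ∀ᵐ x, Tendsto (fun n => ∇ (v n) x) atTop (𝓝 (∇ w x)) := by
  obtain ⟨δ, -, hδ, hδ0⟩ := exists_seq_strictAnti_tendsto (0 : ℝ)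
  have hlip (n : ℕ) : LipschitzWith K fun x => w x + -δ n := lipschitzWith_add_const hw.lip _
  refine ⟨fun n => (fun x => w x + -δ n)⁺, fun n => ⟨lipschitzWith_posPart (hlip n),
    fun x hx => max_eq_right (by simp [hw.zero x hx, (hδ n).le])⟩, fun n => ?_, fun x => ?_, ?_⟩
  · refine (closure_minimal (t := {x | δ n ≤ w x}) (fun x hx => ?_)
      (isClosed_le continuous_const hw.lip.continuous)).trans fun x hx => ?_
    · by_contra h
      have hlt : w x < δ n := not_le.1 h
      exact hx (posPart_eq_zero.2 (by linarith : w x + -δ n ≤ 0))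
    · by_contra h
      exact (hδ n).not_ge (hw.zero x h ▸ hx)
  · have h0 : 0 ≤ w x := hw0 x
    simpa [Pi.posPart_apply, posPart_def, max_eq_left h0] using
      (hδ0.neg.const_add (w x)).max (tendsto_const_nhds (x := (0 : ℝ)))
  · filter_upwards [ae_gradient_eq_zero_of_eq_zero hw.lip] with x hx
    simp only [gradient_posPart (hlip _).continuous, gradient_add_const]
    rcases (hw0 x).eq_or_lt with h | h
    · refine tendsto_const_nhds.congr fun n => (indicator_apply_eq_zero.2 fun _ => hx h.symm).symm ▸
        hx h.symm
    · refine tendsto_const_nhds.congr' ?_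
      filter_upwards [hδ0.eventually_lt_const h] with n hn
      exact (indicator_of_mem (by simpa using hn) _).symm

end Mollification

section SquareIntegrable

variable {α F : Type*} [MeasurableSpace α] {μ : Measure α} [NormedAddCommGroup F]
  [InnerProductSpace ℝ F] {q : α → F}

theorem tendsto_toLp_of_bound [IsFiniteMeasure μ] {w : ℕ → α → F} (hw : ∀ n, MemLp (w n) 2 μ)
    (hq : MemLp q 2 μ) {C : ℝ} (hC : ∀ n, ∀ᵐ x ∂μ, ‖w n x‖ ≤ C)
    (hlim : ∀ᵐ x ∂μ, Tendsto (fun n => w n x) atTop (𝓝 (q x))) :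
    Tendsto (fun n => (hw n).toLp (w n)) atTop (𝓝 (hq.toLp q)) := by
  have hqC : ∀ᵐ x ∂μ, ‖q x‖ ≤ C := by
    filter_upwards [hlim, ae_all_iff.2 hC] with x hx h
    exact le_of_tendsto hx.norm (.of_forall h)
  have hint : Tendsto (fun n => ∫ x, ‖w n x - q x‖ ^ 2 ∂μ) atTop (𝓝 (∫ _, (0 : ℝ) ∂μ)) := by
    refine tendsto_integral_of_dominated_convergence (fun _ => (C + C) ^ 2)
      (fun n => ((hw n).1.sub hq.1).norm.pow 2) (integrable_const _) (fun n => ?_) ?_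
    · filter_upwards [hC n, hqC] with x hx hx'
      rw [Real.norm_eq_abs, abs_of_nonneg (by positivity)]
      gcongr
      exact (norm_sub_le _ _).trans (add_le_add hx hx')
    · filter_upwards [hlim] with x hx
      simpa using (hx.sub_const (q x)).norm.pow 2
  have hnorm (n : ℕ) : ‖(hw n).toLp (w n) - hq.toLp q‖ = √(∫ x, ‖w n x - q x‖ ^ 2 ∂μ) := by
    rw [← MemLp.toLp_sub, ← Real.sqrt_sq (norm_nonneg _), norm_toLp_sq]
    rfl
  rw [tendsto_iff_norm_sub_tendsto_zero]
  simpa only [hnorm, integral_zero, Real.sqrt_zero] using hint.sqrt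

theorem integral_inner_eq_inner_toLp (hq : MemLp q 2 μ) (w : Lp F 2 μ) :
    ∫ x, inner ℝ (q x) (w x) ∂μ = inner ℝ (hq.toLp q) w := by
  rw [L2.inner_def]
  refine integral_congr_ae ?_
  filter_upwards [hq.coeFn_toLp] with x hx
  rw [hx]

theorem continuous_integral_inner (hq : MemLp q 2 μ) :
    Continuous fun w : Lp F 2 μ => ∫ x, inner ℝ (q x) (w x) ∂μ := by
  simp only [integral_inner_eq_inner_toLp hq]
  fun_prop

theorem integrable_inner_of_memLp (hq : MemLp q 2 μ) (w : Lp F 2 μ) :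
    Integrable (fun x => inner ℝ (q x) (w x)) μ := by
  refine (L2.integrable_inner (𝕜 := ℝ) (hq.toLp q) w).congr ?_
  filter_upwards [hq.coeFn_toLp] with x hx
  rw [hx]

end SquareIntegrable

section Rectangle

variable (a b : ℝ)

theorem isOpen_rect : IsOpen (rect a b) := by
  have h (i : Fin 2) : Continuous fun x : Plane => x i := by fun_prop
  exact (isOpen_Ioo.preimage (h 0)).inter (isOpen_Ioo.preimage (h 1))

theorem convex_rect : Convex ℝ (rect a b) := by
  have h (i : Fin 2) (c : ℝ) : Convex ℝ {x : Plane | x i ∈ Ioo 0 c} :=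
    (convex_Ioo 0 c).linear_preimage (EuclideanSpace.proj i : Plane →L[ℝ] ℝ).toLinearMap
  exact (h 0 a).inter (h 1 b)

theorem isBounded_rect : Bornology.IsBounded (rect a b) := by
  refine ((PiLp.antilipschitzWith_ofLp 2 fun _ : Fin 2 => ℝ).isBounded_preimage
    (isBounded_Icc 0 ![a, b])).subset fun x hx => ?_
  simp only [mem_preimage, mem_Icc, Pi.le_def, Fin.forall_fin_two]
  exact ⟨⟨hx.1.1.le, hx.2.1.le⟩, hx.1.2.le, hx.2.2.le⟩

instance isFiniteMeasure_restrict_rect : IsFiniteMeasure (volume.restrict (rect a b)) :=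
  ⟨by simpa using (isBounded_rect a b).measure_lt_top⟩

end Rectangle

section Pairs

variable {a b : ℝ} {K C : ℝ≥0} {u v : Plane → ℝ}

namespace VanishingLip

theorem memLp_rect (hu : VanishingLip (rect a b) K u) : MemLp u 2 (volume.restrict (rect a b)) :=
  (hu.memLp (isBounded_rect a b)).restrict _

theorem memLp_gradient_rect (hu : VanishingLip (rect a b) K u) :
    MemLp (∇ u) 2 (volume.restrict (rect a b)) :=
  (hu.memLp_gradient (isBounded_rect a b)).restrict _

/-- The pair `(u, ∇u)` representing a Lipschitz function that vanishes outside the rectangle. -/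
def toPair (hu : VanishingLip (rect a b) K u) : L2Pair a b :=
  (hu.memLp_rect.toLp u, hu.memLp_gradient_rect.toLp (∇ u))

theorem fst_toPair_ae_eq (hu : VanishingLip (rect a b) K u) :
    hu.toPair.1 =ᵐ[volume.restrict (rect a b)] u :=
  hu.memLp_rect.coeFn_toLp

theorem snd_toPair_ae_eq (hu : VanishingLip (rect a b) K u) :
    hu.toPair.2 =ᵐ[volume.restrict (rect a b)] ∇ u :=
  hu.memLp_gradient_rect.coeFn_toLp

theorem toPair_sub (hu : VanishingLip (rect a b) K u) (hv : VanishingLip (rect a b) C v) :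
    (hu.sub hv).toPair = hu.toPair - hv.toPair := by
  refine Prod.ext rfl (Lp.ext ?_)
  filter_upwards [(hu.sub hv).snd_toPair_ae_eq, hu.snd_toPair_ae_eq, hv.snd_toPair_ae_eq,
    Lp.coeFn_sub hu.toPair.2 hv.toPair.2,
    ae_restrict_of_ae (hu.lip.ae_differentiableAt (μ := volume)),
    ae_restrict_of_ae (hv.lip.ae_differentiableAt (μ := volume))] with x h hx hx' hsub hud hvd
  rw [h, gradient_sub hud hvd, Prod.snd_sub, hsub, Pi.sub_apply, hx, hx']

theorem integral_fst_toPair_mul (hu : VanishingLip (rect a b) K u) (r : Plane → ℝ) :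
    ∫ x in rect a b, hu.toPair.1 x * r x = ∫ x, u x * r x := by
  rw [← setIntegral_eq_integral_of_forall_compl_eq_zero (s := rect a b) (f := fun x => u x * r x)
    fun x hx => by rw [hu.zero x hx, zero_mul]]
  refine integral_congr_ae ?_
  filter_upwards [hu.fst_toPair_ae_eq] with x hx
  rw [hx]

theorem integral_inner_snd_toPair (hu : VanishingLip (rect a b) K u) (q : Plane → Plane) :
    ∫ x in rect a b, inner ℝ (q x) (hu.toPair.2 x) = ∫ x, inner ℝ (q x) (∇ u x) := by
  rw [← setIntegral_eq_integral_of_ae_compl_eq_zero (s := rect a b)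
    (hu.ae_gradient_eq_zero.mono fun x hx h => by rw [hx h, inner_zero_right])]
  refine integral_congr_ae ?_
  filter_upwards [hu.snd_toPair_ae_eq] with x hx
  rw [hx]

theorem norm_fst_toPair_sq (hu : VanishingLip (rect a b) K u) :
    ‖hu.toPair.1‖ ^ 2 = ∫ x, u x ^ 2 := by
  rw [toPair, norm_toLp_sq, setIntegral_eq_integral_of_forall_compl_eq_zero
    fun x hx => by simp [hu.zero x hx]]
  simp only [Real.norm_eq_abs, sq_abs]

theorem norm_snd_toPair_sq (hu : VanishingLip (rect a b) K u) :
    ‖hu.toPair.2‖ ^ 2 = ∫ x, ‖∇ u x‖ ^ 2 := by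
  rw [toPair, norm_toLp_sq, setIntegral_eq_integral_of_ae_compl_eq_zero
    (hu.ae_gradient_eq_zero.mono fun x hx h => by simp [hx h])]

theorem tendsto_toPair {w : ℕ → Plane → ℝ} (hw : ∀ n, VanishingLip (rect a b) K (w n))
    (hu : VanishingLip (rect a b) C u) (hwu : ∀ x, Tendsto (fun n => w n x) atTop (𝓝 (u x)))
    (hgrad : ∀ᵐ x, Tendsto (fun n => ∇ (w n) x) atTop (𝓝 (∇ u x))) :
    Tendsto (fun n => (hw n).toPair) atTop (𝓝 hu.toPair) := by
  obtain ⟨R, hR, hΩR⟩ := (isBounded_rect a b).subset_ball_lt 0 0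
  exact Tendsto.prodMk_nhds
    (tendsto_toLp_of_bound _ _ (fun n => .of_forall ((hw n).abs_le hR.le hΩR)) (.of_forall hwu))
    (tendsto_toLp_of_bound _ _ (fun n => .of_forall (norm_gradient_le (hw n).lip))
      (ae_restrict_of_ae hgrad))

end VanishingLip

theorem IsTest.exists_vanishingLip {ψ : Plane → ℝ} (hψ : IsTest a b ψ) :
    ∃ K : ℝ≥0, VanishingLip (rect a b) K ψ := by
  obtain ⟨K, hK⟩ := ContDiff.lipschitzWith_of_hasCompactSupport hψ.2.1 hψ.1 (by simp)
  exact ⟨K, hK, fun x hx => image_eq_zero_of_notMem_tsupport fun h => hx (hψ.2.2 h)⟩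

theorem mem_testPairs_iff {w : L2Pair a b} : w ∈ testPairs a b ↔
    ∃ (K : ℝ≥0) (ψ : Plane → ℝ) (hψ : VanishingLip (rect a b) K ψ),
      IsTest a b ψ ∧ w = hψ.toPair := by
  refine ⟨fun ⟨ψ, hψ, h1, h2⟩ => ?_, ?_⟩
  · obtain ⟨K, hv⟩ := hψ.exists_vanishingLip
    exact ⟨K, ψ, hv, hψ, Prod.ext (Lp.ext (h1.trans hv.fst_toPair_ae_eq.symm))
      (Lp.ext (h2.trans hv.snd_toPair_ae_eq.symm))⟩
  · rintro ⟨K, ψ, hv, hψ, rfl⟩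
    exact ⟨ψ, hψ, hv.fst_toPair_ae_eq, hv.snd_toPair_ae_eq⟩

theorem toPair_mem_closure_testPairs_of_tsupport_subset (hu : VanishingLip (rect a b) K u)
    (hs : tsupport u ⊆ rect a b) : hu.toPair ∈ closure (testPairs a b) := by
  obtain ⟨ψ, hψ, hψs, hlip, hlim, hgrad⟩ :=
    hu.exists_contDiff_tendsto (isOpen_rect a b) (isBounded_rect a b) hs
  have hv (n : ℕ) : VanishingLip (rect a b) K (ψ n) :=
    ⟨hlip n, fun x hx => image_eq_zero_of_notMem_tsupport fun h => hx (hψs n h)⟩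
  refine mem_closure_of_tendsto (VanishingLip.tendsto_toPair hv hu hlim hgrad)
    (.of_forall fun n => mem_testPairs_iff.2 ⟨K, ψ n, hv n, ?_, rfl⟩)
  exact ⟨hψ n, (hv n).hasCompactSupport (isBounded_rect a b), hψs n⟩

theorem toPair_mem_closure_testPairs (hu : VanishingLip (rect a b) K u) (hu0 : 0 ≤ u) :
    hu.toPair ∈ closure (testPairs a b) := by
  obtain ⟨w, hw, hs, hlim, hgrad⟩ := hu.exists_tsupport_subset_tendsto hu0
  exact isClosed_closure.mem_of_tendsto (VanishingLip.tendsto_toPair hw hu hlim hgrad)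
    (.of_forall fun n => toPair_mem_closure_testPairs_of_tsupport_subset (hw n) (hs n))

end Pairs

section Sobolev

variable {a b : ℝ} {w w' : L2Pair a b}

theorem continuous_integral_fst (a b : ℝ) :
    Continuous fun w : L2Pair a b => ∫ x in rect a b, w.1 x := by
  have h : Continuous fun w : L2Pair a b => ∫ x in rect a b, inner ℝ (1 : ℝ) (w.1 x) :=
    (continuous_integral_inner (memLp_const 1)).comp continuous_fst
  simpa using h

theorem isClosed_H1 (a b : ℝ) : IsClosed (H1 a b) := by
  simp only [H1, ofPred_forall]
  refine isClosed_iInter fun ψ => isClosed_iInter fun hψ => isClosed_iInter fun e => ?_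
  obtain ⟨K, hK⟩ := hψ.exists_vanishingLip
  have hl := (continuous_integral_inner (hK.memLp_gradient_rect.inner_const e)).comp
    (continuous_fst (X := Lp ℝ 2 (volume.restrict (rect a b)))
      (Y := Lp Plane 2 (volume.restrict (rect a b))))
  have hψe : MemLp (fun x => ψ x • e) 2 (volume.restrict (rect a b)) :=
    (ContinuousLinearMap.toSpanSingleton ℝ e).comp_memLp' hK.memLp_rect
  have hr := (continuous_integral_inner hψe).comp
    (continuous_snd (X := Lp ℝ 2 (volume.restrict (rect a b)))
      (Y := Lp Plane 2 (volume.restrict (rect a b))))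
  convert! isClosed_eq hl hr.neg using 3 with w
  simp [real_inner_smul_left, real_inner_comm e, mul_comm]

theorem testPairs_subset_H1 (a b : ℝ) : testPairs a b ⊆ H1 a b := by
  rintro w hw ψ hψ e
  obtain ⟨C, η, hη, -, rfl⟩ := mem_testPairs_iff.1 hw
  obtain ⟨K, hK⟩ := hψ.exists_vanishingLip
  have h := integral_inner_gradient_mul hη.lip hK.lip
    (hK.hasCompactSupport (isBounded_rect a b)) e
  have hr := hη.integral_inner_snd_toPair fun x => ψ x • e
  simp only [real_inner_smul_left, real_inner_comm _ e, mul_comm (ψ _)] at hr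
  rw [hη.integral_fst_toPair_mul, hr, h, neg_neg]

theorem H10_eq_closure (a b : ℝ) : H10 a b = closure (testPairs a b) :=
  inter_eq_right.2 ((isClosed_H1 a b).closure_subset_iff.2 (testPairs_subset_H1 a b))

theorem toPair_mem_H10 {K : ℝ≥0} {u : Plane → ℝ} (hu : VanishingLip (rect a b) K u)
    (hu0 : 0 ≤ u) : hu.toPair ∈ H10 a b :=
  H10_eq_closure a b ▸ toPair_mem_closure_testPairs hu hu0

theorem H10_induction {p : L2Pair a b → Prop} (hp : IsClosed {w | p w})
    (htoPair : ∀ (K : ℝ≥0) (ψ : Plane → ℝ) (hψ : VanishingLip (rect a b) K ψ), p hψ.toPair)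
    (hw : w ∈ H10 a b) : p w := by
  rw [H10_eq_closure] at hw
  refine hp.closure_subset_iff.2 (fun v hv => ?_) hw
  obtain ⟨K, ψ, hψ, -, rfl⟩ := mem_testPairs_iff.1 hv
  exact htoPair K ψ hψ

theorem sub_mem_H10 (hw : w ∈ H10 a b) (hw' : w' ∈ H10 a b) : w - w' ∈ H10 a b := by
  rw [H10_eq_closure] at *
  refine map_mem_closure₂ continuous_sub hw hw' fun v hv v' hv' => ?_
  obtain ⟨K, ψ, hψ, ht, rfl⟩ := mem_testPairs_iff.1 hv
  obtain ⟨C, η, hη, ht', rfl⟩ := mem_testPairs_iff.1 hv'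
  exact mem_testPairs_iff.2 ⟨K + C, ψ - η, hψ.sub hη, ⟨ht.1.sub ht'.1, ht.2.1.sub ht'.2.1,
    (tsupport_sub ψ η).trans (union_subset ht.2.2 ht'.2.2)⟩, (hψ.toPair_sub hη).symm⟩

theorem exists_norm_le_mul_norm_snd (a b : ℝ) :
    ∃ C : ℝ, ∀ w ∈ H10 a b, ‖w‖ ≤ C * ‖w.2‖ := by
  obtain ⟨R, hR, hΩ⟩ := (isBounded_rect a b).subset_ball_lt 0 0
  have hfst (w) (hw : w ∈ H10 a b) : ‖w.1‖ ≤ 2 * R * ‖w.2‖ := by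
    refine H10_induction (p := fun w => ‖w.1‖ ≤ 2 * R * ‖w.2‖)
      (isClosed_le (by fun_prop) (by fun_prop)) (fun K ψ hψ => ?_) hw
    refine le_of_sq_le_sq ?_ (by positivity)
    rw [mul_pow, hψ.norm_fst_toPair_sq, hψ.norm_snd_toPair_sq]
    exact (hψ.integral_sq_le hR.le hΩ).trans_eq (by ring)
  refine ⟨max (2 * R) 1, fun w hw => max_le ((hfst w hw).trans ?_)
    (le_mul_of_one_le_left (norm_nonneg _) (le_max_right _ _))⟩
  exact mul_le_mul_of_nonneg_right (le_max_left _ _) (norm_nonneg _)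

end Sobolev

section Plasticity

theorem plasticity_eq (θ : Param) (s : ℝ) :
    plasticity θ s = 1 / θ.1.2.2 * max (s / θ.1.2.1) 1 ^ ((1 - θ.1.1) / 2) := by
  have hξ := θ.2.2.1
  rw [plasticity]
  split_ifs with h
  · rw [max_eq_right ((div_le_one hξ).2 h), Real.one_rpow, mul_one]
  · rw [max_eq_left ((one_le_div hξ).2 (not_le.1 h).le)]

theorem isStiffness_plasticity (θ : Param) : IsStiffness (plasticity θ) (1 / θ.1.2.2) := by
  have hξ := θ.2.2.1
  have hG := θ.2.2.2
  have hκ : 0 ≤ (1 - θ.1.1) / 2 := by linarith [θ.2.1.2]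
  refine ⟨by positivity, ?_, fun s t hst => ?_, fun s => ?_⟩
  · simp only [funext (plasticity_eq θ)]
    exact continuous_const.mul (Continuous.rpow_const (by fun_prop) fun s => Or.inr hκ)
  · rw [plasticity_eq, plasticity_eq]
    gcongr
  · rw [plasticity_eq]
    exact le_mul_of_one_le_right (by positivity) (Real.one_le_rpow (le_max_right _ _) hκ)

theorem continuous_plasticity_param (s : ℝ) : Continuous fun θ : Param => plasticity θ s := by
  have hκ : Continuous fun θ : Param => θ.1.1 := by fun_prop
  have hξ : Continuous fun θ : Param => θ.1.2.1 := by fun_prop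
  have hG : Continuous fun θ : Param => θ.1.2.2 := by fun_prop
  simp only [plasticity_eq]
  refine (continuous_const.div hG fun θ => θ.2.2.2.ne').mul (Continuous.rpow
    ((continuous_const.div hξ fun θ => θ.2.2.1.ne').max continuous_const)
    ((continuous_const.sub hκ).div_const 2) fun θ => Or.inl ?_)
  exact (one_pos.trans_le (le_max_right _ _)).ne'

theorem plasticity_mul_inner (θ : Param) (p q : Plane) :
    plasticity θ (‖p‖ ^ 2) * inner ℝ p q = inner ℝ (flux (plasticity θ) p) q := by
  rw [flux, real_inner_smul_left]

end Plasticity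

section Flux

variable {a b : ℝ} {p : Lp Plane 2 (volume.restrict (rect a b))} {L : ℝ}

theorem memLp_flux {g : ℝ → ℝ} {c : ℝ} (hg : IsStiffness g c)
    (hp : ∀ᵐ x ∂volume.restrict (rect a b), ‖p x‖ ≤ L) :
    MemLp (fun x => flux g (p x)) 2 (volume.restrict (rect a b)) :=
  MemLp.of_bound (hg.continuous_flux.comp_aestronglyMeasurable (Lp.aestronglyMeasurable p))
    (g (L ^ 2) * L) (hp.mono fun _ => hg.norm_flux_le)

theorem tendsto_toLp_flux_plasticity (hp : ∀ᵐ x ∂volume.restrict (rect a b), ‖p x‖ ≤ L)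
    {θs : ℕ → Param} {θ : Param} (hθ : Tendsto θs atTop (𝓝 θ)) :
    Tendsto (fun n => (memLp_flux (isStiffness_plasticity (θs n)) hp).toLp _) atTop
      (𝓝 ((memLp_flux (isStiffness_plasticity θ) hp).toLp _)) := by
  have hlim (s : ℝ) : Tendsto (fun n => plasticity (θs n) s) atTop (𝓝 (plasticity θ s)) :=
    ((continuous_plasticity_param s).tendsto θ).comp hθ
  obtain ⟨C, hC⟩ := ((hlim (L ^ 2)).mul_const L).bddAbove_range
  refine tendsto_toLp_of_bound (C := C) _ _ (fun n => ?_)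
    (.of_forall fun x => (hlim _).smul_const _)
  filter_upwards [hp] with x hx
  exact ((isStiffness_plasticity (θs n)).norm_flux_le hx).trans (hC ⟨n, rfl⟩)

end Flux

section WeakSolution

variable {a b φ L : ℝ} {θ θ' : Param} {w w' : L2Pair a b}

theorem VanishingLip.isWeakSolution_toPair {K : ℝ≥0} {u : Plane → ℝ}
    (hu : VanishingLip (rect a b) K u) (hu0 : 0 ≤ u)
    (hEL : ∀ (D : ℝ≥0) (v : Plane → ℝ), VanishingLip (rect a b) D v →
      ∫ x, inner ℝ (flux (plasticity θ) (∇ u x)) (∇ v x) = 2 * φ * ∫ x, v x) :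
    IsWeakSolution a b θ φ hu.toPair := by
  have hK : ∀ᵐ x ∂volume.restrict (rect a b), ‖hu.toPair.2 x‖ ≤ K :=
    hu.snd_toPair_ae_eq.mono fun x hx => hx ▸ norm_gradient_le hu.lip x
  have hq := memLp_flux (isStiffness_plasticity θ) hK
  refine ⟨toPair_mem_H10 hu hu0, fun v hv => ?_⟩
  simp only [plasticity_mul_inner]
  refine ⟨integrable_inner_of_memLp hq v.2, H10_induction (p := fun v =>
      ∫ x in rect a b, inner ℝ (flux (plasticity θ) (hu.toPair.2 x)) (v.2 x) =
        2 * φ * ∫ x in rect a b, v.1 x)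
    (isClosed_eq ((continuous_integral_inner hq).comp continuous_snd)
      (continuous_const.mul (continuous_integral_fst a b))) (fun D ψ hψ => ?_) hv⟩
  have hfst : ∫ x in rect a b, hψ.toPair.1 x = ∫ x, ψ x := by
    simpa using hψ.integral_fst_toPair_mul fun _ => 1
  rw [hfst, ← hEL D ψ hψ, ← hψ.integral_inner_snd_toPair fun x => flux (plasticity θ) (∇ u x)]
  refine integral_congr_ae ?_
  filter_upwards [hu.snd_toPair_ae_eq] with x hx
  rw [hx]

theorem exists_bounded_isWeakSolution (a b : ℝ) (θ : Param) (hφ : 0 ≤ φ) :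
    ∃ w : L2Pair a b, IsWeakSolution a b θ φ w ∧
      ∃ L : ℝ, ∀ᵐ x ∂volume.restrict (rect a b), ‖w.2 x‖ ≤ L := by
  obtain ⟨L, u, hu, hu0, hEL⟩ := exists_lipschitz_solution (isOpen_rect a b) (convex_rect a b)
    (isBounded_rect a b) (isStiffness_plasticity θ) (by positivity : 0 ≤ 2 * φ)
  exact ⟨hu.toPair, hu.isWeakSolution_toPair hu0 hEL, L,
    hu.snd_toPair_ae_eq.mono fun x hx => hx ▸ norm_gradient_le hu.lip x⟩

theorem IsWeakSolution.norm_snd_sub_le (hw : IsWeakSolution a b θ φ w)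
    (hw' : IsWeakSolution a b θ' φ w') (hL : ∀ᵐ x ∂volume.restrict (rect a b), ‖w'.2 x‖ ≤ L) :
    ‖(w - w').2‖ ≤ θ.1.2.2 * ‖(memLp_flux (isStiffness_plasticity θ') hL).toLp _ -
      (memLp_flux (isStiffness_plasticity θ) hL).toLp _‖ := by
  have hv := sub_mem_H10 hw.1 hw'.1
  have hG := θ.2.2.2
  set v := w - w' with hvdef
  set q := (memLp_flux (isStiffness_plasticity θ) hL).toLp _
  set q' := (memLp_flux (isStiffness_plasticity θ') hL).toLp _
  obtain ⟨hint, heq⟩ := hw.2 v hv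
  obtain ⟨-, heq'⟩ := hw'.2 v hv
  simp only [plasticity_mul_inner] at hint heq heq'
  have hint' := integrable_inner_of_memLp (memLp_flux (isStiffness_plasticity θ) hL) v.2
  have henergy : 1 / θ.1.2.2 * ‖v.2‖ ^ 2 ≤ inner ℝ (q' - q) v.2 := by
    rw [inner_sub_left, ← integral_inner_eq_inner_toLp, ← integral_inner_eq_inner_toLp, heq',
      ← heq, ← integral_sub hint hint', ← real_inner_self_eq_norm_sq, L2.inner_def,
      ← integral_const_mul]
    refine integral_mono_ae ((L2.integrable_inner (𝕜 := ℝ) _ _).const_mul _) (hint.sub hint') ?_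
    filter_upwards [Lp.coeFn_sub w.2 w'.2] with x hx
    simp only [hvdef, Prod.snd_sub, hx, Pi.sub_apply, ← inner_sub_left,
      real_inner_self_eq_norm_sq]
    exact (isStiffness_plasticity θ).mul_norm_sub_sq_le_inner_flux_sub _ _
  have hsq := henergy.trans (real_inner_le_norm _ _)
  rw [one_div, inv_mul_le_iff₀ hG, sq, ← mul_assoc] at hsq
  rcases (norm_nonneg v.2).eq_or_lt with h0 | h0
  · rw [← h0]
    positivity
  · exact le_of_mul_le_mul_right hsq h0

theorem IsWeakSolution.eq_of_bound (hw : IsWeakSolution a b θ φ w)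
    (hw' : IsWeakSolution a b θ φ w')
    (hL : ∀ᵐ x ∂volume.restrict (rect a b), ‖w'.2 x‖ ≤ L) : w = w' := by
  obtain ⟨C, hC⟩ := exists_norm_le_mul_norm_snd a b
  have hgrad : ‖(w - w').2‖ = 0 :=
    le_antisymm (by simpa using hw.norm_snd_sub_le hw' hL) (norm_nonneg _)
  have h := hC _ (sub_mem_H10 hw.1 hw'.1)
  rw [hgrad, mul_zero] at h
  exact sub_eq_zero.1 (norm_le_zero_iff.1 h)

theorem existsUnique_isWeakSolution (a b : ℝ) (θ : Param) (hφ : 0 ≤ φ) :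
    ∃! w : L2Pair a b, IsWeakSolution a b θ φ w := by
  obtain ⟨w, hw, L, hL⟩ := exists_bounded_isWeakSolution a b θ hφ
  exact ⟨w, hw, fun w' hw' => hw'.eq_of_bound hw hL⟩

theorem isWeakSolution_solution (a b : ℝ) (θ : Param) (hφ : 0 ≤ φ) :
    IsWeakSolution a b θ φ (solution a b θ φ) :=
  Classical.epsilon_spec (existsUnique_isWeakSolution a b θ hφ).exists

theorem exists_bound_solution (a b : ℝ) (θ : Param) (hφ : 0 ≤ φ) :
    ∃ L : ℝ, ∀ᵐ x ∂volume.restrict (rect a b), ‖(solution a b θ φ).2 x‖ ≤ L := by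
  obtain ⟨w, hw, L, hL⟩ := exists_bounded_isWeakSolution a b θ hφ
  exact ⟨L, (isWeakSolution_solution a b θ hφ).eq_of_bound hw hL ▸ hL⟩

theorem continuous_solution (a b : ℝ) (hφ : 0 ≤ φ) :
    Continuous fun θ : Param => solution a b θ φ := by
  refine continuous_iff_seqContinuous.2 fun θs θ hθ => tendsto_iff_norm_sub_tendsto_zero.2 ?_
  obtain ⟨L, hL⟩ := exists_bound_solution a b θ hφ
  obtain ⟨C, hC⟩ := exists_norm_le_mul_norm_snd a b
  have hw (θ : Param) := isWeakSolution_solution a b θ hφ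
  have hG : Tendsto (fun n => (θs n).1.2.2) atTop (𝓝 θ.1.2.2) :=
    ((by fun_prop : Continuous fun θ : Param => θ.1.2.2).tendsto θ).comp hθ
  have hflux := ((tendsto_toLp_flux_plasticity hL hθ).const_sub
    ((memLp_flux (isStiffness_plasticity θ) hL).toLp _)).norm
  have hgrad : Tendsto (fun n => ‖(solution a b (θs n) φ - solution a b θ φ).2‖) atTop (𝓝 0) :=
    squeeze_zero (fun n => norm_nonneg _) (fun n => (hw (θs n)).norm_snd_sub_le (hw θ) hL)
      (by simpa using hG.mul hflux)
  exact squeeze_zero (fun n => norm_nonneg _)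
    (fun n => hC _ (sub_mem_H10 (hw (θs n)).1 (hw θ).1)) (by simpa using hgrad.const_mul C)

theorem continuous_observe (a b : ℝ) {M : ℕ} {φ : Fin M → ℝ} (hφ : ∀ i, 0 ≤ φ i) :
    Continuous (observe a b φ) :=
  (PiLp.continuous_toLp 2 _).comp <| continuous_pi fun i =>
    continuous_const.mul ((continuous_integral_fst a b).comp (continuous_solution a b (hφ i)))

end WeakSolution

section Gaussian

variable {M : ℕ} {σ : ℝ}

/-- The Lebesgue density of the centred Gaussian law on `ℝ^M` with covariance `σ² I`, with the
exponent written as in `likelihood`. -/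
def isotropicGaussianPDF (σ : ℝ) (x : Data M) : ℝ :=
  ((2 * Real.pi * σ ^ 2) ^ (M / 2 : ℝ))⁻¹ * Real.exp (-(1 / 2) * ‖σ⁻¹ • x‖ ^ 2)

theorem isotropicGaussianPDF_nonneg (σ : ℝ) (x : Data M) : 0 ≤ isotropicGaussianPDF σ x := by
  unfold isotropicGaussianPDF
  positivity

theorem continuous_isotropicGaussianPDF (σ : ℝ) :
    Continuous (isotropicGaussianPDF σ : Data M → ℝ) := by
  unfold isotropicGaussianPDF
  fun_prop

theorem isotropicGaussianPDF_eq (σ : ℝ) (x : Data M) :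
    isotropicGaussianPDF σ x =
      ((2 * Real.pi * σ ^ 2) ^ (M / 2 : ℝ))⁻¹ * Real.exp (-(2 * σ ^ 2)⁻¹ * ‖x‖ ^ 2) := by
  rw [isotropicGaussianPDF, norm_smul, mul_pow, norm_inv, inv_pow, Real.norm_eq_abs, sq_abs]
  ring_nf

theorem integrable_isotropicGaussianPDF (hσ : 0 < σ) :
    Integrable (isotropicGaussianPDF σ : Data M → ℝ) := by
  refine Integrable.of_integral_ne_zero (ne_of_gt ?_)
  simp only [isotropicGaussianPDF_eq]
  rw [integral_const_mul, GaussianFourier.integral_rexp_neg_mul_sq_norm (by positivity)]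
  positivity

theorem integral_isotropicGaussianPDF_mul_cexp (hσ : 0 < σ) (t : Data M) :
    ∫ x : Data M, (isotropicGaussianPDF σ x : ℂ) * Complex.exp (inner ℝ x t * Complex.I) =
      Complex.exp (-(σ ^ 2 * ‖t‖ ^ 2 / 2 : ℝ)) := by
  have hσ' : (σ : ℂ) ≠ 0 := by exact_mod_cast hσ.ne'
  set N : ℝ := (2 * Real.pi * σ ^ 2) ^ (M / 2 : ℝ) with hN
  set b : ℂ := (((2 * σ ^ 2)⁻¹ : ℝ) : ℂ) with hb
  have hN0 : (N : ℂ) ≠ 0 := by exact_mod_cast (by positivity : N ≠ 0)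
  have hbre : 0 < b.re := by rw [hb, Complex.ofReal_re]; positivity
  have hpow : (Real.pi / b) ^ (Module.finrank ℝ (Data M) / 2 : ℂ) = N := by
    rw [hN, Complex.ofReal_cpow (by positivity), hb, finrank_euclideanSpace_fin]
    push_cast
    congr 1
    field_simp
  calc ∫ x : Data M, (isotropicGaussianPDF σ x : ℂ) * Complex.exp (inner ℝ x t * Complex.I)
      = ∫ x : Data M, (N : ℂ)⁻¹ *
          Complex.exp (-b * ‖x‖ ^ 2 + Complex.I * (inner ℝ t x : ℝ)) := by
        refine integral_congr_ae (.of_forall fun x => ?_)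
        simp only [isotropicGaussianPDF_eq, ← hN, hb, Complex.exp_add, real_inner_comm,
          mul_comm Complex.I]
        push_cast
        ring
    _ = Complex.exp (Complex.I ^ 2 * ‖t‖ ^ 2 / (4 * b)) := by
        rw [integral_const_mul, GaussianFourier.integral_cexp_neg_mul_sq_norm_add hbre, hpow,
          inv_mul_cancel_left₀ hN0]
    _ = _ := by
        rw [hb, Complex.I_sq]
        push_cast
        congr 1
        field_simp
        norm_num

theorem multivariateGaussian_eq_withDensity (hσ : 0 < σ) :
    multivariateGaussian 0 (σ ^ 2 • (1 : Matrix (Fin M) (Fin M) ℝ)) =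
      volume.withDensity fun x => ENNReal.ofReal (isotropicGaussianPDF σ x) := by
  have hquad (t : Data M) :
      t.ofLp ⬝ᵥ (σ ^ 2 • (1 : Matrix (Fin M) (Fin M) ℝ)).mulVec t.ofLp = σ ^ 2 * ‖t‖ ^ 2 := by
    rw [Matrix.smul_mulVec, Matrix.one_mulVec, dotProduct_smul, smul_eq_mul,
      EuclideanSpace.norm_sq_eq]
    simp [dotProduct, sq]
  have := isFiniteMeasure_withDensity_ofReal
    (integrable_isotropicGaussianPDF (M := M) hσ).hasFiniteIntegral
  refine Measure.ext_of_charFun (funext fun t => ?_)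
  rw [charFun_multivariateGaussian (Matrix.PosSemidef.one.smul (by positivity)), hquad,
    charFun_apply, integral_withDensity_eq_integral_toReal_smul
      (continuous_isotropicGaussianPDF σ).measurable.ennreal_ofReal
      (.of_forall fun x => ENNReal.ofReal_lt_top)]
  simp only [ENNReal.toReal_ofReal (isotropicGaussianPDF_nonneg σ _), Complex.real_smul,
    integral_isotropicGaussianPDF_mul_cexp hσ]
  simp

end Gaussian

section ConditionalLaw

variable {S A B : Type*} [MeasurableSpace S] [MeasurableSpace A] [MeasurableSpace B]

theorem map_withDensity_comp {μ : Measure A} {T : A → B} (hT : Measurable T) {f : B → ℝ≥0∞}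
    (hf : Measurable f) : (μ.withDensity (f ∘ T)).map T = (μ.map T).withDensity f := by
  ext s hs
  rw [Measure.map_apply hT hs, withDensity_apply _ (hT hs), withDensity_apply _ hs,
    setLIntegral_map hs hf hT]
  rfl

theorem measurePreserving_add_left_swap [AddGroup B] [MeasurableAdd₂ B] (μ : Measure A)
    [SFinite μ] (ν : Measure B) [SFinite ν] [ν.IsAddLeftInvariant] {F : A → B}
    (hF : Measurable F) :
    MeasurePreserving (fun p : A × B => (F p.1 + p.2, p.1)) (μ.prod ν) (ν.prod μ) :=
  Measure.measurePreserving_swap.comp <|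
    (MeasurePreserving.id μ).skew_product ((hF.comp measurable_fst).add measurable_snd)
      (.of_forall fun t => map_add_left_eq_self ν (F t))

theorem map_add_indep_eq_withDensity [AddGroup B] [MeasurableAdd₂ B] [MeasurableNeg B]
    {P : Measure S} [IsFiniteMeasure P] {ν : Measure B} [SFinite ν] [ν.IsAddLeftInvariant]
    {X : S → A} {ε : S → B} {F : A → B} {ρ : B → ℝ≥0∞} (hX : Measurable X) (hε : Measurable ε)
    (hF : Measurable F) (hρ : Measurable ρ) (hεl : P.map ε = ν.withDensity ρ)
    (hind : IndepFun X ε P) :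
    P.map (fun s => (F (X s) + ε s, X s)) =
      (ν.prod (P.map X)).withDensity fun p => ρ (-F p.2 + p.1) := by
  let T : A × B → B × A := fun p => (F p.1 + p.2, p.1)
  let f : B × A → ℝ≥0∞ := fun p => ρ (-F p.2 + p.1)
  have hT : MeasurePreserving T ((P.map X).prod ν) (ν.prod (P.map X)) :=
    measurePreserving_add_left_swap (P.map X) ν hF
  have hf : Measurable f := hρ.comp ((hF.comp measurable_snd).neg.add measurable_fst)
  have : SFinite (ν.withDensity ρ) := hεl ▸ inferInstance
  calc P.map (fun s => (F (X s) + ε s, X s))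
      = (P.map fun s => (X s, ε s)).map T := (Measure.map_map hT.measurable (hX.prodMk hε)).symm
    _ = (((P.map X).prod ν).withDensity (f ∘ T)).map T := by
        rw [(indepFun_iff_map_prod_eq_prod_map_map hX.aemeasurable hε.aemeasurable).1 hind, hεl,
          prod_withDensity_right hρ]
        simp only [Function.comp_def, f, T, neg_add_cancel_left]
    _ = (ν.prod (P.map X)).withDensity f := by
        rw [map_withDensity_comp hT.measurable hf, hT.map_eq]

theorem withDensity_compProd_withDensity_const {ν : Measure B} [SFinite ν] {μ : Measure A}
    [SFinite μ] {Z : B → ℝ≥0∞} {q : B → A → ℝ≥0∞} (hZ : Measurable Z)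
    (hq : Measurable (Function.uncurry q))
    [IsSFiniteKernel ((Kernel.const B μ).withDensity q)] :
    ν.withDensity Z ⊗ₘ (Kernel.const B μ).withDensity q =
      (ν.prod μ).withDensity fun p => Z p.1 * q p.1 p.2 := by
  rw [Measure.compProd_withDensity hq, Measure.compProd_const, prod_withDensity_left hZ,
    ← withDensity_mul _ (by fun_prop) (by exact hq)]
  rfl

theorem isConditionalLaw_of_map_eq_compProd {P : Measure S} {X : S → A} {Y : S → B}
    {K : Kernel B A} [IsMarkovKernel K] {ρ : Measure B} [SFinite ρ] (hX : Measurable X)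
    (h : P.map (fun s => (Y s, X s)) = ρ ⊗ₘ K) : IsConditionalLaw P X Y K := by
  have hρ : P.map Y = ρ := by
    rw [← Measure.fst_map_prodMk hX, h, Measure.fst_compProd]
  rw [IsConditionalLaw, h, hρ]

theorem IsConditionalLaw.ae_eq [MeasurableSpace.CountableOrCountablyGenerated B A]
    {P : Measure S} [IsFiniteMeasure P] {X : S → A} {Y : S → B} {K K' : Kernel B A}
    [IsFiniteKernel K] [IsFiniteKernel K'] (hK : IsConditionalLaw P X Y K)
    (hK' : IsConditionalLaw P X Y K') : ∀ᵐ y ∂P.map Y, K y = K' y :=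
  Kernel.ae_eq_of_compProd_eq (hK.symm.trans hK')

end ConditionalLaw

section Bayes

variable {M : ℕ} {F : Param → Data M} {σ : ℝ} {μ₀ : Measure Param}

theorem likelihood_pos (F : Param → Data M) (σ : ℝ) (y : Data M) (θ : Param) :
    0 < likelihood F σ y θ := Real.exp_pos _

theorem likelihood_le_one (F : Param → Data M) (σ : ℝ) (y : Data M) (θ : Param) :
    likelihood F σ y θ ≤ 1 := by
  rw [likelihood, Real.exp_le_one_iff]
  have := sq_nonneg ‖σ⁻¹ • (y - F θ)‖
  linarith

theorem measurable_likelihood (hF : Measurable F) (σ : ℝ) :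
    Measurable fun p : Data M × Param => likelihood F σ p.1 p.2 := by
  unfold likelihood
  fun_prop

theorem measurable_likelihood_right (hF : Measurable F) (σ : ℝ) (y : Data M) :
    Measurable (likelihood F σ y) := by
  unfold likelihood
  fun_prop

theorem integrable_likelihood [IsFiniteMeasure μ₀] (hF : Measurable F) (σ : ℝ) (y : Data M) :
    Integrable (likelihood F σ y) μ₀ :=
  Integrable.of_bound (measurable_likelihood_right hF σ y).aestronglyMeasurable 1
    (.of_forall fun θ => by
      rw [Real.norm_of_nonneg (likelihood_pos F σ y θ).le]
      exact likelihood_le_one F σ y θ)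

theorem evidence_eq_ofReal [IsFiniteMeasure μ₀] (hF : Measurable F) (σ : ℝ) (y : Data M) :
    evidence F σ μ₀ y = ENNReal.ofReal (∫ θ, likelihood F σ y θ ∂μ₀) :=
  (ofReal_integral_eq_lintegral_ofReal (integrable_likelihood hF σ y)
    (.of_forall fun θ => (likelihood_pos F σ y θ).le)).symm

theorem integral_likelihood_pos [IsFiniteMeasure μ₀] [NeZero μ₀] (hF : Measurable F) (σ : ℝ)
    (y : Data M) : 0 < ∫ θ, likelihood F σ y θ ∂μ₀ :=
  integral_exp_pos (integrable_likelihood hF σ y)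

theorem evidence_pos [IsFiniteMeasure μ₀] [NeZero μ₀] (hF : Measurable F) (σ : ℝ) (y : Data M) :
    0 < evidence F σ μ₀ y := by
  rw [evidence_eq_ofReal hF]
  exact ENNReal.ofReal_pos.2 (integral_likelihood_pos hF σ y)

theorem evidence_lt_top [IsFiniteMeasure μ₀] (hF : Measurable F) (σ : ℝ) (y : Data M) :
    evidence F σ μ₀ y < ⊤ := by
  rw [evidence_eq_ofReal hF]
  exact ENNReal.ofReal_lt_top

theorem measurable_evidence [SFinite μ₀] (hF : Measurable F) (σ : ℝ) :
    Measurable (evidence F σ μ₀) :=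
  (measurable_likelihood hF σ).ennreal_ofReal.lintegral_prod_right'

/-- The density `Z(y)⁻¹ exp(-½ ‖C^{-1/2}(y - F(θ))‖²)` of the posterior with respect to the
prior. -/
def posteriorDensity (F : Param → Data M) (σ : ℝ) (μ₀ : Measure Param) (y : Data M)
    (θ : Param) : ℝ≥0∞ :=
  (evidence F σ μ₀ y)⁻¹ * ENNReal.ofReal (likelihood F σ y θ)

theorem measurable_posteriorDensity [SFinite μ₀] (hF : Measurable F) (σ : ℝ) :
    Measurable (Function.uncurry (posteriorDensity F σ μ₀)) :=
  ((measurable_evidence hF σ).comp measurable_fst).inv.mul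
    (measurable_likelihood hF σ).ennreal_ofReal

theorem bayesMeasure_eq_withDensity (hF : Measurable F) (σ : ℝ) (y : Data M) :
    bayesMeasure F σ μ₀ y = μ₀.withDensity (posteriorDensity F σ μ₀ y) :=
  (withDensity_smul _ (measurable_likelihood_right hF σ y).ennreal_ofReal).symm

theorem isProbabilityMeasure_bayesMeasure [IsFiniteMeasure μ₀] [NeZero μ₀] (hF : Measurable F)
    (σ : ℝ) (y : Data M) : IsProbabilityMeasure (bayesMeasure F σ μ₀ y) := by
  refine ⟨?_⟩
  rw [bayesMeasure, Measure.smul_apply, withDensity_apply _ MeasurableSet.univ,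
    Measure.restrict_univ, smul_eq_mul]
  exact ENNReal.inv_mul_cancel (evidence_pos hF σ y).ne' (evidence_lt_top hF σ y).ne

/-- The Bayes measures as a kernel from the data to the parameters. It is defined through
densities, so that measurability in the data is automatic. -/
def posteriorKernel (F : Param → Data M) (σ : ℝ) (μ₀ : Measure Param) [SFinite μ₀] :
    Kernel (Data M) Param :=
  (Kernel.const _ μ₀).withDensity (posteriorDensity F σ μ₀)

theorem posteriorKernel_apply [SFinite μ₀] (hF : Measurable F) (σ : ℝ) (y : Data M) :
    posteriorKernel F σ μ₀ y = bayesMeasure F σ μ₀ y := by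
  rw [posteriorKernel, Kernel.withDensity_apply _ (measurable_posteriorDensity hF σ),
    Kernel.const_apply, bayesMeasure_eq_withDensity hF]

theorem isMarkovKernel_posteriorKernel [IsFiniteMeasure μ₀] [NeZero μ₀] (hF : Measurable F)
    (σ : ℝ) : IsMarkovKernel (posteriorKernel F σ μ₀) :=
  ⟨fun y => posteriorKernel_apply (μ₀ := μ₀) hF σ y ▸ isProbabilityMeasure_bayesMeasure hF σ y⟩

theorem evidence_mul_posteriorDensity [IsFiniteMeasure μ₀] [NeZero μ₀] (hF : Measurable F)
    (σ : ℝ) (y : Data M) (θ : Param) :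
    evidence F σ μ₀ y * posteriorDensity F σ μ₀ y θ = ENNReal.ofReal (likelihood F σ y θ) :=
  ENNReal.mul_inv_cancel_left (evidence_pos hF σ y).ne' (evidence_lt_top hF σ y).ne

theorem isConditionalLaw_posteriorKernel {S : Type*} [MeasurableSpace S] {P : Measure S}
    [IsFiniteMeasure P] [IsFiniteMeasure μ₀] [NeZero μ₀] (hF : Measurable F) (hσ : 0 < σ)
    {θ : S → Param} {ε : S → Data M} (hθ : Measurable θ) (hε : Measurable ε) (hθl : P.map θ = μ₀)
    (hεl : P.map ε = multivariateGaussian 0 (σ ^ 2 • (1 : Matrix (Fin M) (Fin M) ℝ)))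
    (hind : IndepFun θ ε P) :
    IsConditionalLaw P θ (fun s => F (θ s) + ε s) (posteriorKernel F σ μ₀) := by
  set c : ℝ := ((2 * Real.pi * σ ^ 2) ^ (M / 2 : ℝ))⁻¹
  have hmarkov := isMarkovKernel_posteriorKernel (μ₀ := μ₀) hF σ
  refine isConditionalLaw_of_map_eq_compProd hθ
    (ρ := volume.withDensity fun y => ENNReal.ofReal c * evidence F σ μ₀ y) ?_
  rw [posteriorKernel] at hmarkov ⊢
  rw [withDensity_compProd_withDensity_const ((measurable_evidence hF σ).const_mul _)
      (measurable_posteriorDensity hF σ),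
    map_add_indep_eq_withDensity hθ hε hF
      (continuous_isotropicGaussianPDF σ).measurable.ennreal_ofReal
      (hεl.trans (multivariateGaussian_eq_withDensity hσ)) hind, hθl]
  congr 1 with ⟨y, t⟩
  rw [mul_assoc, evidence_mul_posteriorDensity hF, ← ENNReal.ofReal_mul (by positivity),
    isotropicGaussianPDF, likelihood, neg_add_eq_sub]

end Bayes

section Hellinger

variable {A : Type*} [MeasurableSpace A] {μ : Measure A} {f g : A → ℝ}

theorem rnDeriv_withDensity_ofReal_ae_eq (hf : Measurable f) (hg : Measurable g)
    (hf0 : ∀ x, 0 ≤ f x) (hfg : ∀ x, f x ≤ g x)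
    [SigmaFinite (μ.withDensity fun x => ENNReal.ofReal (g x))] :
    (μ.withDensity fun x => ENNReal.ofReal (f x)).rnDeriv
        (μ.withDensity fun x => ENNReal.ofReal (g x))
      =ᵐ[μ.withDensity fun x => ENNReal.ofReal (g x)] fun x => ENNReal.ofReal (f x / g x) := by
  have hm : Measurable fun x => ENNReal.ofReal (f x / g x) := (hf.div hg).ennreal_ofReal
  have hmul : (μ.withDensity fun x => ENNReal.ofReal (f x)) =
      (μ.withDensity fun x => ENNReal.ofReal (g x)).withDensity
        fun x => ENNReal.ofReal (f x / g x) := by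
    rw [← withDensity_mul _ hg.ennreal_ofReal hm]
    congr 1 with x
    rw [Pi.mul_apply, ← ENNReal.ofReal_mul ((hf0 x).trans (hfg x)),
      mul_div_cancel_of_imp' fun h => le_antisymm (h ▸ hfg x) (hf0 x)]
  rw [hmul]
  exact Measure.rnDeriv_withDensity _ hm

theorem mul_sqrt_div_sub_sqrt_div_sq {s t u : ℝ} (hs : 0 ≤ s) (ht : 0 ≤ t) (hu : 0 ≤ u)
    (h : u = 0 → s = 0 ∧ t = 0) : u * (√(s / u) - √(t / u)) ^ 2 = (√s - √t) ^ 2 := by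
  rcases hu.eq_or_lt with hu | hu
  · simp [h hu.symm]
  · rw [Real.sqrt_div hs, Real.sqrt_div ht, ← sub_div, div_pow, Real.sq_sqrt hu.le,
      mul_div_cancel₀ _ hu.ne']

theorem hellingerDist_withDensity (hf : Measurable f) (hg : Measurable g) (hf0 : ∀ x, 0 ≤ f x)
    (hg0 : ∀ x, 0 ≤ g x) [IsFiniteMeasure (μ.withDensity fun x => ENNReal.ofReal (f x))]
    [IsFiniteMeasure (μ.withDensity fun x => ENNReal.ofReal (g x))] :
    hellingerDist (μ.withDensity fun x => ENNReal.ofReal (f x))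
      (μ.withDensity fun x => ENNReal.ofReal (g x)) =
      √(1 / 2 * ∫ x, (√(f x) - √(g x)) ^ 2 ∂μ) := by
  have hm : Measurable fun x => f x + g x := hf.add hg
  have hsum : (μ.withDensity fun x => ENNReal.ofReal (f x)) +
      (μ.withDensity fun x => ENNReal.ofReal (g x)) =
      μ.withDensity fun x => ENNReal.ofReal (f x + g x) := by
    rw [← withDensity_add_left hf.ennreal_ofReal]
    congr 1 with x
    exact (ENNReal.ofReal_add (hf0 x) (hg0 x)).symm
  have : IsFiniteMeasure (μ.withDensity fun x => ENNReal.ofReal (f x + g x)) :=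
    hsum ▸ inferInstance
  have hdf := rnDeriv_withDensity_ofReal_ae_eq (μ := μ) hf hm hf0
    fun x => le_add_of_nonneg_right (hg0 x)
  have hdg := rnDeriv_withDensity_ofReal_ae_eq (μ := μ) hg hm hg0
    fun x => le_add_of_nonneg_left (hf0 x)
  have hfg (x : A) : 0 ≤ f x + g x := add_nonneg (hf0 x) (hg0 x)
  rw [hellingerDist, hsum]
  congr 2
  calc _ = ∫ x, (√(f x / (f x + g x)) - √(g x / (f x + g x))) ^ 2
          ∂μ.withDensity fun x => ENNReal.ofReal (f x + g x) := by
        refine integral_congr_ae ?_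
        filter_upwards [hdf, hdg] with x hx hx'
        rw [hx, hx', ENNReal.toReal_ofReal (div_nonneg (hf0 x) (hfg x)),
          ENNReal.toReal_ofReal (div_nonneg (hg0 x) (hfg x))]
    _ = ∫ x, (√(f x) - √(g x)) ^ 2 ∂μ := by
        rw [integral_withDensity_eq_integral_toReal_smul hm.ennreal_ofReal
          (.of_forall fun x => ENNReal.ofReal_lt_top)]
        refine integral_congr_ae (.of_forall fun x => ?_)
        simp only [ENNReal.toReal_ofReal (hfg x), smul_eq_mul]
        exact mul_sqrt_div_sub_sqrt_div_sq (hf0 x) (hg0 x) (hfg x)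
          (add_eq_zero_iff_of_nonneg (hf0 x) (hg0 x)).1

theorem hellingerDist_withDensity_le [IsProbabilityMeasure μ] (hf : Measurable f)
    (hg : Measurable g) (hf0 : ∀ x, 0 ≤ f x) (hg0 : ∀ x, 0 ≤ g x)
    [IsFiniteMeasure (μ.withDensity fun x => ENNReal.ofReal (f x))]
    [IsFiniteMeasure (μ.withDensity fun x => ENNReal.ofReal (g x))] {C : ℝ}
    (hC : ∀ x, |√(f x) - √(g x)| ≤ C) :
    hellingerDist (μ.withDensity fun x => ENNReal.ofReal (f x))
      (μ.withDensity fun x => ENNReal.ofReal (g x)) ≤ C := by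
  have : Nonempty A := μ.nonempty_of_neZero
  have hC0 : 0 ≤ C := (abs_nonneg _).trans (hC (Classical.arbitrary A))
  have hint : ∫ x, (√(f x) - √(g x)) ^ 2 ∂μ ≤ C ^ 2 := by
    refine (integral_mono_of_nonneg (.of_forall fun x => sq_nonneg _) (integrable_const (C ^ 2))
      (.of_forall fun x => ?_)).trans (by simp)
    exact sq_le_sq' (neg_le_of_abs_le (hC x)) (le_of_abs_le (hC x))
  rw [hellingerDist_withDensity hf hg hf0 hg0]
  refine Real.sqrt_le_iff.2 ⟨hC0, ?_⟩
  linarith [sq_nonneg C]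

end Hellinger

section PosteriorStability

theorem abs_exp_neg_sq_sub_le (s t : ℝ) :
    |Real.exp (-(1 / 4) * s ^ 2) - Real.exp (-(1 / 4) * t ^ 2)| ≤ |s - t| := by
  have hderiv (r : ℝ) : HasDerivAt (fun r : ℝ => Real.exp (-(1 / 4) * r ^ 2))
      (Real.exp (-(1 / 4) * r ^ 2) * (-(1 / 4) * (2 * r))) r := by
    simpa using ((hasDerivAt_pow 2 r).const_mul (-(1 / 4 : ℝ))).exp
  have hlip : LipschitzWith 1 fun r : ℝ => Real.exp (-(1 / 4) * r ^ 2) := by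
    refine lipschitzWith_of_nnnorm_deriv_le (fun r => (hderiv r).differentiableAt) fun r => ?_
    rw [(hderiv r).deriv, ← NNReal.coe_le_coe, coe_nnnorm, norm_mul, Real.norm_eq_abs,
      Real.abs_exp, NNReal.coe_one, neg_mul, Real.exp_neg, inv_mul_le_iff₀ (Real.exp_pos _),
      mul_one, Real.norm_eq_abs]
    refine le_trans (abs_le.2 ⟨?_, ?_⟩) (Real.add_one_le_exp (1 / 4 * r ^ 2)) <;>
      nlinarith [sq_nonneg (r - 1), sq_nonneg (r + 1)]
  simpa [Real.dist_eq] using hlip.dist_le_mul s t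

theorem abs_inv_sqrt_sub_inv_sqrt_le {m s t : ℝ} (hm : 0 < m) (hs : m ≤ s) (ht : m ≤ t) :
    |(√s)⁻¹ - (√t)⁻¹| ≤ (2 * √m * m)⁻¹ * |s - t| := by
  have hs0 : 0 < √s := Real.sqrt_pos.2 (hm.trans_le hs)
  have ht0 : 0 < √t := Real.sqrt_pos.2 (hm.trans_le ht)
  have hfactor : (√s)⁻¹ - (√t)⁻¹ = ((√s + √t) * (√s * √t))⁻¹ * (t - s) := by
    rw [← Real.sq_sqrt (hm.trans_le hs).le, ← Real.sq_sqrt (hm.trans_le ht).le,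
      Real.sqrt_sq hs0.le, Real.sqrt_sq ht0.le]
    field_simp
    ring
  have hle : 2 * √m * m ≤ (√s + √t) * (√s * √t) :=
    calc 2 * √m * m = (√m + √m) * (√m * √m) := by rw [Real.mul_self_sqrt hm.le]; ring
      _ ≤ (√s + √t) * (√s * √t) := by gcongr
  rw [hfactor, abs_mul, abs_of_pos (by positivity), abs_sub_comm]
  gcongr

variable {M : ℕ} {F : Param → Data M} {σ : ℝ} {μ₀ : Measure Param}

theorem sqrt_likelihood (F : Param → Data M) (σ : ℝ) (y : Data M) (θ : Param) :
    √(likelihood F σ y θ) = Real.exp (-(1 / 4) * ‖σ⁻¹ • (y - F θ)‖ ^ 2) := by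
  rw [likelihood, Real.sqrt_eq_iff_mul_self_eq (Real.exp_pos _).le (Real.exp_pos _).le,
    ← Real.exp_add]
  ring_nf

theorem abs_sqrt_likelihood_sub_le (hσ : 0 < σ) (y y' : Data M) (θ : Param) :
    |√(likelihood F σ y θ) - √(likelihood F σ y' θ)| ≤ σ⁻¹ * ‖y - y'‖ := by
  rw [sqrt_likelihood, sqrt_likelihood]
  refine (abs_exp_neg_sq_sub_le _ _).trans ((abs_norm_sub_norm_le _ _).trans_eq ?_)
  rw [← smul_sub, sub_sub_sub_cancel_right, norm_smul, Real.norm_of_nonneg (inv_pos.2 hσ).le]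

theorem abs_likelihood_sub_le (hσ : 0 < σ) (y y' : Data M) (θ : Param) :
    |likelihood F σ y θ - likelihood F σ y' θ| ≤ 2 * σ⁻¹ * ‖y - y'‖ := by
  have hsqrt := abs_sqrt_likelihood_sub_le (F := F) hσ y y' θ
  have hle (z : Data M) : √(likelihood F σ z θ) ≤ 1 :=
    Real.sqrt_le_one.2 (likelihood_le_one F σ z θ)
  rw [← Real.sq_sqrt (likelihood_pos F σ y θ).le, ← Real.sq_sqrt (likelihood_pos F σ y' θ).le,
    sq_sub_sq, abs_mul, abs_of_nonneg (by positivity), mul_assoc]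
  gcongr
  linarith [hle y, hle y']

theorem exists_pos_le_integral_likelihood [IsFiniteMeasure μ₀] [NeZero μ₀] (hF : Measurable F)
    (hσ : 0 < σ) (r : ℝ) :
    ∃ m > 0, ∀ y : Data M, ‖y‖ ≤ r → m ≤ ∫ θ, likelihood F σ y θ ∂μ₀ := by
  have hint : Integrable (fun θ => Real.exp (-(1 / 2) * (σ⁻¹ * (r + ‖F θ‖)) ^ 2)) μ₀ := by
    refine Integrable.of_bound (by fun_prop : Measurable _).aestronglyMeasurable 1
      (.of_forall fun θ => ?_)
    rw [Real.norm_eq_abs, Real.abs_exp, Real.exp_le_one_iff]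
    linarith [sq_nonneg (σ⁻¹ * (r + ‖F θ‖))]
  refine ⟨_, integral_exp_pos hint, fun y hy =>
    integral_mono hint (integrable_likelihood hF σ y) fun θ => ?_⟩
  have hnorm : ‖σ⁻¹ • (y - F θ)‖ ≤ σ⁻¹ * (r + ‖F θ‖) := by
    rw [norm_smul, Real.norm_of_nonneg (inv_pos.2 hσ).le]
    gcongr
    exact (norm_sub_le _ _).trans (by gcongr)
  have hsq := pow_le_pow_left₀ (norm_nonneg _) hnorm 2
  exact Real.exp_le_exp.2 (by linarith)

theorem abs_integral_likelihood_sub_le [IsProbabilityMeasure μ₀] (hF : Measurable F)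
    (hσ : 0 < σ) (y y' : Data M) :
    |∫ θ, likelihood F σ y θ ∂μ₀ - ∫ θ, likelihood F σ y' θ ∂μ₀| ≤ 2 * σ⁻¹ * ‖y - y'‖ := by
  rw [← integral_sub (integrable_likelihood hF σ y) (integrable_likelihood hF σ y'),
    ← Real.norm_eq_abs]
  refine (norm_integral_le_of_norm_le_const (C := 2 * σ⁻¹ * ‖y - y'‖)
    (.of_forall fun θ => abs_likelihood_sub_le hσ y y' θ)).trans (by simp)

theorem bayesMeasure_eq_withDensity_ofReal [IsFiniteMeasure μ₀] [NeZero μ₀] (hF : Measurable F)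
    (σ : ℝ) (y : Data M) : bayesMeasure F σ μ₀ y = μ₀.withDensity fun θ =>
      ENNReal.ofReal ((∫ t, likelihood F σ y t ∂μ₀)⁻¹ * likelihood F σ y θ) := by
  have hpos := integral_likelihood_pos (μ₀ := μ₀) hF σ y
  rw [bayesMeasure_eq_withDensity hF]
  congr 1 with θ
  rw [posteriorDensity, evidence_eq_ofReal hF, ENNReal.ofReal_mul (inv_pos.2 hpos).le,
    ENNReal.ofReal_inv_of_pos hpos]

theorem abs_sqrt_inv_mul_likelihood_sub_le (hσ : 0 < σ) {m z z' : ℝ} (hm : 0 < m) (hz : m ≤ z)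
    (hz' : m ≤ z') {y y' : Data M} (hzz' : |z - z'| ≤ 2 * σ⁻¹ * ‖y - y'‖) (θ : Param) :
    |√(z⁻¹ * likelihood F σ y θ) - √(z'⁻¹ * likelihood F σ y' θ)| ≤
      ((√m)⁻¹ * σ⁻¹ + (2 * √m * m)⁻¹ * (2 * σ⁻¹)) * ‖y - y'‖ := by
  rw [Real.sqrt_mul (inv_nonneg.2 (hm.le.trans hz)), Real.sqrt_mul (inv_nonneg.2 (hm.le.trans hz')),
    Real.sqrt_inv, Real.sqrt_inv]
  set e := √(likelihood F σ y θ)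
  set e' := √(likelihood F σ y' θ)
  have he : |e - e'| ≤ σ⁻¹ * ‖y - y'‖ := abs_sqrt_likelihood_sub_le hσ y y' θ
  have he' : |e'| ≤ 1 := by
    rw [abs_of_nonneg (Real.sqrt_nonneg _)]
    exact Real.sqrt_le_one.2 (likelihood_le_one F σ y' θ)
  have hinv : |(√z)⁻¹| ≤ (√m)⁻¹ := by
    rw [abs_of_nonneg (by positivity)]
    gcongr
  have hdiff : |(√z)⁻¹ - (√z')⁻¹| ≤ (2 * √m * m)⁻¹ * (2 * σ⁻¹ * ‖y - y'‖) :=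
    (abs_inv_sqrt_sub_inv_sqrt_le hm hz hz').trans (by gcongr)
  calc |(√z)⁻¹ * e - (√z')⁻¹ * e'|
      = |(√z)⁻¹ * (e - e') + ((√z)⁻¹ - (√z')⁻¹) * e'| := by ring_nf
    _ ≤ |(√z)⁻¹| * |e - e'| + |(√z)⁻¹ - (√z')⁻¹| * |e'| := by
        simpa only [abs_mul] using abs_add_le ((√z)⁻¹ * (e - e')) (((√z)⁻¹ - (√z')⁻¹) * e')
    _ ≤ (√m)⁻¹ * (σ⁻¹ * ‖y - y'‖) + (2 * √m * m)⁻¹ * (2 * σ⁻¹ * ‖y - y'‖) * 1 := by gcongr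
    _ = _ := by ring

theorem exists_hellingerDist_bayesMeasure_le [IsProbabilityMeasure μ₀] (hF : Measurable F)
    (hσ : 0 < σ) (r : ℝ) : ∃ L : ℝ, ∀ y y' : Data M, ‖y‖ ≤ r → ‖y'‖ ≤ r →
      hellingerDist (bayesMeasure F σ μ₀ y) (bayesMeasure F σ μ₀ y') ≤ L * ‖y - y'‖ := by
  obtain ⟨m, hm, hle⟩ := exists_pos_le_integral_likelihood (μ₀ := μ₀) hF hσ r
  refine ⟨(√m)⁻¹ * σ⁻¹ + (2 * √m * m)⁻¹ * (2 * σ⁻¹), fun y y' hy hy' => ?_⟩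
  have hfin (z : Data M) : IsFiniteMeasure (μ₀.withDensity fun θ =>
      ENNReal.ofReal ((∫ t, likelihood F σ z t ∂μ₀)⁻¹ * likelihood F σ z θ)) := by
    have := isProbabilityMeasure_bayesMeasure (μ₀ := μ₀) hF σ z
    rw [← bayesMeasure_eq_withDensity_ofReal hF]
    infer_instance
  have hmeas (z : Data M) :
      Measurable fun θ => (∫ t, likelihood F σ z t ∂μ₀)⁻¹ * likelihood F σ z θ :=
    (measurable_likelihood_right hF σ z).const_mul _
  have hnonneg (z : Data M) (θ : Param) :
      0 ≤ (∫ t, likelihood F σ z t ∂μ₀)⁻¹ * likelihood F σ z θ :=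
    mul_nonneg (inv_nonneg.2 (integral_likelihood_pos hF σ z).le) (likelihood_pos F σ z θ).le
  rw [bayesMeasure_eq_withDensity_ofReal hF, bayesMeasure_eq_withDensity_ofReal hF]
  exact hellingerDist_withDensity_le (hmeas y) (hmeas y') (hnonneg y) (hnonneg y')
    (abs_sqrt_inv_mul_likelihood_sub_le hσ hm (hle y hy) (hle y' hy')
      (abs_integral_likelihood_sub_le hF hσ y y'))

end PosteriorStability

end Torsion

end

theorem theorem3 (a b : ℝ) (ha : 0 < a) (hb : 0 < b) {M : ℕ} (φ : Fin M → ℝ)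
    (hφ : ∀ i, 0 < φ i) (σ : ℝ) (hσ : 0 < σ)
    (μ₀ : Measure Torsion.Param) [IsProbabilityMeasure μ₀] :
    -- the observation operator is well-defined: the direct problem is uniquely solvable
    (∀ (θ : Torsion.Param) (i : Fin M), ∃! w : Torsion.L2Pair a b,
      Torsion.IsWeakSolution a b θ (φ i) w) ∧
    -- the normalizing constant in Bayes' rule is positive and finite
    (∀ y : Torsion.Data M, 0 < Torsion.evidence (Torsion.observe a b φ) σ μ₀ y ∧
      Torsion.evidence (Torsion.observe a b φ) σ μ₀ y < ⊤) ∧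
    -- the posterior exists, is given by Bayes' rule, and is the conditional law of `θ` given `d`
    (∃ post : Kernel (Torsion.Data M) Torsion.Param, IsMarkovKernel post ∧
      (∀ y, post y = Torsion.bayesMeasure (Torsion.observe a b φ) σ μ₀ y) ∧
      ∀ (S : Type*) [MeasurableSpace S] (P : Measure S) [IsProbabilityMeasure P]
        (θ : S → Torsion.Param) (ε : S → Torsion.Data M),
        Measurable θ → Measurable ε → P.map θ = μ₀ →
        P.map ε = multivariateGaussian 0 (σ ^ 2 • (1 : Matrix (Fin M) (Fin M) ℝ)) →
        IndepFun θ ε P →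
        Measurable (fun s => Torsion.observe a b φ (θ s) + ε s) ∧
        Torsion.IsConditionalLaw P θ (fun s => Torsion.observe a b φ (θ s) + ε s) post ∧
        ∀ K : Kernel (Torsion.Data M) Torsion.Param, IsMarkovKernel K →
          Torsion.IsConditionalLaw P θ (fun s => Torsion.observe a b φ (θ s) + ε s) K →
          ∀ᵐ y ∂(P.map fun s => Torsion.observe a b φ (θ s) + ε s), K y = post y) ∧
    -- the posterior depends locally Lipschitz continuously on the data in Hellinger distance
    (∀ r : ℝ, 0 < r → ∃ L : ℝ, ∀ y y' : Torsion.Data M, ‖y‖ ≤ r → ‖y'‖ ≤ r →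
      Torsion.hellingerDist (Torsion.bayesMeasure (Torsion.observe a b φ) σ μ₀ y)
        (Torsion.bayesMeasure (Torsion.observe a b φ) σ μ₀ y') ≤ L * ‖y - y'‖) := by
  have hF : Measurable (Torsion.observe a b φ) :=
    (Torsion.continuous_observe a b fun i => (hφ i).le).measurable
  have hpost := Torsion.isMarkovKernel_posteriorKernel (μ₀ := μ₀) hF σ
  refine ⟨fun θ i => Torsion.existsUnique_isWeakSolution a b θ (hφ i).le,
    fun y => ⟨Torsion.evidence_pos hF σ y, Torsion.evidence_lt_top hF σ y⟩,
    ⟨Torsion.posteriorKernel (Torsion.observe a b φ) σ μ₀, hpost,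
      Torsion.posteriorKernel_apply hF σ, fun S _ P _ θ ε hθ hε hθlaw hεlaw hind => ?_⟩,
    fun r _ => Torsion.exists_hellingerDist_bayesMeasure_le hF hσ r⟩
  have hcond := Torsion.isConditionalLaw_posteriorKernel hF hσ hθ hε hθlaw hεlaw hind
  exact ⟨(hF.comp hθ).add hε, hcond, fun K _ hK => hK.ae_eq hcond⟩
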